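/- Let $d\ge 1$ and $n\ge 0$ be integers, let $\bar d=d$ if $d$ is odd and $\bar d=2d$ if $d$ is even, let $\zeta\in\mathbb{C}$ be a primitive $\bar d$-th root of unity, and put $\xi=\zeta^2$ and $\mathbb{Z}_d=\mathbb{Z}/d\mathbb{Z}$. Let $\mathbb{C}^d$ have the orthonormal basis $(v_i)_{i\in\mathbb{Z}_d}$, and let $X v_i=v_{i+1}$, $Z v_i=\xi^i v_i$. For $1\le r\le n$ let $X_r,Z_r$ be the operators $X,Z$ acting on the $r$-th factor of $V=(\mathbb{C}^d)^{\otimes n}$. The Pauli group $\mathcal{P}_n\subset GL(V)$ is the group generated by all $X_r$, all $Z_r$ and the scalar $\zeta$ (so $\mathcal{P}_0=\langle\zeta\rangle$ acts on $(\mathbb{C}^d)^{\otimes 0}=\mathbb{C}$). Let $\mathcal{M}$ be the free $\mathbb{Z}_d$-module with basis $z_1,\dots,z_n,x_1,\dots,x_n$ and with the symplectic form $\phi$ given by $\phi(z_i,z_j)=\phi(x_i,x_j)=0$ and $\phi(z_i,x_j)=-\phi(x_j,z_i)=\delta_{ij}$. For a submodule $N\subset\mathcal{M}$ let $N^\perp$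 be its orthogonal. Let $\tau\colon\mathcal{P}_n\to\mathcal{M}$ be the homomorphism with kernel $\langle\zeta\rangle$ such that $\tau(Z_r)=z_r$ and $\tau(X_r)=x_r$. A symplectic basis of $\mathcal{M}$ is a basis $(e_1,\dots,e_n,f_1,\dots,f_n)$ with $\phi(e_i,e_j)=\phi(f_i,f_j)=0$ and $\phi(e_i,f_j)=\delta_{ij}$. A subgroup $H\subset\mathcal{P}_n$ is called *shifted free* if there are an integer $0\le k\le n$, an abelian subgroup $H'\subset\mathcal{P}_n$ with $H'\cap\langle\zeta\rangle=\{I\}$ and $H'\simeq\mathbb{Z}_d^k$, a symplectic basis $(e_1,\dots,e_n,f_1,\dots,f_n)$ of $\mathcal{M}$ such that $(e_1,\dots,e_k)$ is a basis of $\tau(H')$, elements $Z'_1,\dots,Z'_n,X'_1,\dots,X'_n\in\mathcal{P}_n$ with $\tau(Z'_r)=e_r$ and $\tau(X'_r)=f_r$ which satisfy the relations of the standard generators (the $X'_r$ commute with each other, the $Z'_r$ commute with each other, $X'_r$ commutes with $Z'_s$ for $r\ne s$, $Z'_rX'_r=\zeta^2X'_rZ'_r$, and ${X'_r}^d={Z'_r}^d=I$)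 and for which $H'=\langle Z'_1,\dots,Z'_k\rangle$, and positive divisors $a_1,\dots,a_k$ of $d$ such that $$H=\langle {Z'_1}^{a_1},\dots,{Z'_k}^{a_k},{X'_1}^{d/a_1},\dots,{X'_k}^{d/a_k}\rangle .$$ For a subgroup $H\subset\mathcal{P}_n$ let $N(H)$ be its normaliser in $\mathcal{P}_n$ and let $V^H=\{v\in V\mid hv=v\text{ for all }h\in H\}$, on which $N(H)/H$ acts. **Theorem.** Let $H$ be an abelian subgroup of $\mathcal{P}_n$ with $H\cap\langle\zeta\rangle=\{I\}$. The following are equivalent: (a) the group $N(H)/H$ is isomorphic to $\mathcal{P}_{n-k}$ for some integer $0\le k\le n$; (b) $H$ is shifted free; (c) $\tau(H)$ is Lagrangian inside a free symplectic submodule of $\mathcal{M}$, i.e. there is a free submodule $N\subset\mathcal{M}$ with $N\cap N^\perp=0$, $\tau(H)\subset N$ and $\tau(H)=N\cap\tau(H)^\perp$. Moreover, in this case, for each $k$ as in (a), there are a group isomorphism $\Psi\colon N(H)/H\to\mathcal{P}_{n-k}$ and a unitary isomorphism $U\colon V^H\to(\mathbb{C}^d)^{\otimes(n-k)}$ such that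 $U(g\cdot v)=\Psi(g)\,U(v)$ for all $g\in N(H)/H$ and $v\in V^H$. -/

import Mathlib

noncomputable section

namespace QuditPauli

/-- `d̄ = d` for odd `d` and `d̄ = 2d` for even `d`. -/
def dbar (d : ℕ) : ℕ := if Even d then 2 * d else d

/-! ### Qudit spaces and the operators `X`, `Z`, `ζ` -/

/-- The space `(ℂ^d)^{⊗ n}`, written in its standard orthonormal basis `v_i = v_{i_1} ⊗ ⋯ ⊗ v_{i_n}`,
`i ∈ (ℤ/d)^n`, where `(v_j)`, `j ∈ ℤ/d`, is the standard basis of `ℂ^d`.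
See `tensorEquiv` below for the identification with the tensor power. -/
abbrev Qudits (d n : ℕ) : Type := EuclideanSpace ℂ (Fin n → ZMod d)

/-- The operator `X` on one qudit: `X v_i = v_{i+1}`, i.e. `(X w)_i = w_{i-1}`. -/
def shift (d : ℕ) [NeZero d] : EuclideanSpace ℂ (ZMod d) ≃ₗ[ℂ] EuclideanSpace ℂ (ZMod d) :=
  (LinearIsometryEquiv.piLpCongrLeft 2 ℂ ℂ (Equiv.addRight (1 : ZMod d))).toLinearEquiv

/-- The operator `Z` on one qudit: `Z v_i = ξ^i v_i` with `ξ = ζ²`. -/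
def clock (d : ℕ) [NeZero d] (ζ : ℂˣ) :
    EuclideanSpace ℂ (ZMod d) ≃ₗ[ℂ] EuclideanSpace ℂ (ZMod d) :=
  (WithLp.linearEquiv 2 ℂ (ZMod d → ℂ)).trans
    ((LinearEquiv.piCongrRight fun i : ZMod d =>
      LinearEquiv.smulOfUnit (R := ℂ) (M := ℂ) ((ζ ^ 2) ^ i.val)).trans
    (WithLp.linearEquiv 2 ℂ (ZMod d → ℂ)).symm)

/-- `X_r`, the operator `X` on the `r`-th qudit: `X_r v_i = v_{i + ε_r}`. -/
def opX (d n : ℕ) [NeZero d] (r : Fin n) : Qudits d n ≃ₗ[ℂ] Qudits d n :=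
  (LinearIsometryEquiv.piLpCongrLeft 2 ℂ ℂ
    (Equiv.addRight (Pi.single r 1 : Fin n → ZMod d))).toLinearEquiv

/-- `Z_r`, the operator `Z` on the `r`-th qudit: `Z_r v_i = ξ^{i_r} v_i` with `ξ = ζ²`. -/
def opZ (d n : ℕ) [NeZero d] (ζ : ℂˣ) (r : Fin n) : Qudits d n ≃ₗ[ℂ] Qudits d n :=
  (WithLp.linearEquiv 2 ℂ ((Fin n → ZMod d) → ℂ)).trans
    ((LinearEquiv.piCongrRight fun i : Fin n → ZMod d =>
      LinearEquiv.smulOfUnit (R := ℂ) (M := ℂ) ((ζ ^ 2) ^ (i r).val)).trans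
    (WithLp.linearEquiv 2 ℂ ((Fin n → ZMod d) → ℂ)).symm)

/-- The operator of multiplication by `ζ`. -/
def opScalar (d n : ℕ) (ζ : ℂˣ) : Qudits d n ≃ₗ[ℂ] Qudits d n := LinearEquiv.smulOfUnit ζ

theorem opScalar_apply {d n : ℕ} {ζ : ℂˣ} (v : Qudits d n) (i : Fin n → ZMod d) :
    opScalar d n ζ v i = (ζ : ℂ) * v i := rfl

section Basic

variable {d n : ℕ} [NeZero d] {ζ : ℂˣ}

theorem shift_apply (w : EuclideanSpace ℂ (ZMod d)) (i : ZMod d) :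
    shift d w i = w (i - 1) := by
  simp [shift, sub_eq_add_neg, Equiv.piCongrLeft'_apply]

theorem clock_apply (w : EuclideanSpace ℂ (ZMod d)) (i : ZMod d) :
    clock d ζ w i = ((((ζ ^ 2) ^ i.val : ℂˣ)) : ℂ) * w i := rfl

theorem opX_apply (r : Fin n) (v : Qudits d n) (i : Fin n → ZMod d) :
    opX d n r v i = v (i - Pi.single r 1) := by
  simp [opX, sub_eq_add_neg, Equiv.piCongrLeft'_apply]

theorem opZ_apply (r : Fin n) (v : Qudits d n) (i : Fin n → ZMod d) :
    opZ d n ζ r v i = ((((ζ ^ 2) ^ (i r).val : ℂˣ)) : ℂ) * v i := rfl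

/-! ### `Qudits d n` is the `n`-th tensor power of `ℂ^d` -/

open scoped TensorProduct in
/-- The identification of the tensor power `(ℂ^d)^{⊗ n}` with `Qudits d n`. -/
def tensorEquiv (d n : ℕ) [NeZero d] :
    (⨂[ℂ] _ : Fin n, EuclideanSpace ℂ (ZMod d)) ≃ₗ[ℂ] Qudits d n :=
  (Module.Basis.equivFun (Basis.piTensorProduct fun _ : Fin n =>
      (EuclideanSpace.basisFun (ZMod d) ℂ).toBasis)).trans
    (WithLp.linearEquiv 2 ℂ ((Fin n → ZMod d) → ℂ)).symm

theorem tensorEquiv_tprod (w : Fin n → EuclideanSpace ℂ (ZMod d)) (i : Fin n → ZMod d) :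
    tensorEquiv d n (PiTensorProduct.tprod ℂ w) i = ∏ r, w r (i r) := by
  simp [tensorEquiv, Basis.piTensorProduct_repr_tprod_apply]

/-- The inner product of pure tensors is the product of the inner products. -/
theorem inner_tensorEquiv_tprod (w w' : Fin n → EuclideanSpace ℂ (ZMod d)) :
    inner ℂ (tensorEquiv d n (PiTensorProduct.tprod ℂ w))
      (tensorEquiv d n (PiTensorProduct.tprod ℂ w')) = ∏ r, inner ℂ (w r) (w' r) := by
  simp only [PiLp.inner_apply, tensorEquiv_tprod]
  rw [Finset.prod_univ_sum, Fintype.piFinset_univ]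
  refine Finset.sum_congr rfl fun i _ => ?_
  simp [Finset.prod_mul_distrib]

/-- `X_r` is `X` on the `r`-th tensor factor. -/
theorem opX_tensorEquiv_tprod (r : Fin n) (w : Fin n → EuclideanSpace ℂ (ZMod d)) :
    opX d n r (tensorEquiv d n (PiTensorProduct.tprod ℂ w)) =
      tensorEquiv d n (PiTensorProduct.tprod ℂ (Function.update w r (shift d (w r)))) := by
  ext i
  rw [opX_apply, tensorEquiv_tprod, tensorEquiv_tprod]
  refine Finset.prod_congr rfl fun s _ => ?_
  by_cases h : s = r
  · subst h; simp [shift_apply]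
  · simp [h]

/-- `Z_r` is `Z` on the `r`-th tensor factor. -/
theorem opZ_tensorEquiv_tprod (r : Fin n) (w : Fin n → EuclideanSpace ℂ (ZMod d)) :
    opZ d n ζ r (tensorEquiv d n (PiTensorProduct.tprod ℂ w)) =
      tensorEquiv d n (PiTensorProduct.tprod ℂ (Function.update w r (clock d ζ (w r)))) := by
  ext i
  rw [opZ_apply, tensorEquiv_tprod, tensorEquiv_tprod,
    ← Finset.mul_prod_erase _ _ (Finset.mem_univ r),
    ← Finset.mul_prod_erase _ _ (Finset.mem_univ r), ← mul_assoc]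
  congr 1
  · simp [clock_apply]
  · refine Finset.prod_congr rfl fun s hs => ?_
    simp [Finset.ne_of_mem_erase hs]

end Basic

/-! ### The Pauli group -/

/-- The `n`-qudit Pauli group `P_n ⊆ GL((ℂ^d)^{⊗ n})`, generated by the `X_r`, the `Z_r` and `ζ`. -/
def Pauli (d n : ℕ) [NeZero d] (ζ : ℂˣ) : Subgroup (Qudits d n ≃ₗ[ℂ] Qudits d n) :=
  Subgroup.closure (Set.range (opX d n) ∪ Set.range (opZ d n ζ) ∪ {opScalar d n ζ})

/-- `X_r` as an element of the Pauli group. -/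
def pauliX (d n : ℕ) [NeZero d] (ζ : ℂˣ) (r : Fin n) : Pauli d n ζ :=
  ⟨opX d n r, Subgroup.subset_closure (Or.inl (Or.inl ⟨r, rfl⟩))⟩

/-- `Z_r` as an element of the Pauli group. -/
def pauliZ (d n : ℕ) [NeZero d] (ζ : ℂˣ) (r : Fin n) : Pauli d n ζ :=
  ⟨opZ d n ζ r, Subgroup.subset_closure (Or.inl (Or.inr ⟨r, rfl⟩))⟩

/-- The scalar `ζ` as an element of the Pauli group. -/
def pauliScalar (d n : ℕ) [NeZero d] (ζ : ℂˣ) : Pauli d n ζ :=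
  ⟨opScalar d n ζ, Subgroup.subset_closure (Or.inr rfl)⟩

/-! ### The symplectic module `M` and the homomorphism `τ` -/

/-- The free `ℤ/d`-module `M` with basis `z_1, …, z_n, x_1, …, x_n`; an element is the pair of its
family of `z`-coordinates and its family of `x`-coordinates. -/
abbrev SympMod (d n : ℕ) : Type := (Fin n → ZMod d) × (Fin n → ZMod d)

/-- The symplectic form: `φ(z_i, z_j) = φ(x_i, x_j) = 0`, `φ(z_i, x_j) = -φ(x_j, z_i) = δ_{ij}`. -/
def sympForm (d n : ℕ) : SympMod d n →ₗ[ZMod d] SympMod d n →ₗ[ZMod d] ZMod d :=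
  LinearMap.mk₂ (ZMod d) (fun m m' => m.1 ⬝ᵥ m'.2 - m.2 ⬝ᵥ m'.1)
    (by intros; simp [add_dotProduct]; ring)
    (by intros; simp [smul_dotProduct, mul_sub])
    (by intros; simp [dotProduct_add]; ring)
    (by intros; simp [dotProduct_smul, mul_sub])

section Tau

variable {d n : ℕ} [NeZero d] {ζ : ℂˣ}

theorem isPrimitiveRoot_sq (hζ : IsPrimitiveRoot ζ (dbar d)) : IsPrimitiveRoot (ζ ^ 2) d := by
  have hd : 0 < d := Nat.pos_of_ne_zero (NeZero.ne d)
  unfold dbar at hζ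
  split_ifs at hζ with h
  · exact hζ.pow (by omega) rfl
  · exact hζ.pow_of_coprime 2 (Nat.coprime_two_left.mpr (Nat.not_even_iff_odd.mp h))

/-- The character `t ↦ ξ^t` of `ℤ/d`. -/
def phase (hζ : IsPrimitiveRoot ζ (dbar d)) : AddChar (ZMod d) ℂˣ :=
  AddChar.zmodChar d (isPrimitiveRoot_sq hζ).pow_eq_one

theorem phase_injective (hζ : IsPrimitiveRoot ζ (dbar d)) : Function.Injective (phase hζ) := by
  intro a b hab
  exact ZMod.val_injective d
    ((isPrimitiveRoot_sq hζ).pow_inj (ZMod.val_lt a) (ZMod.val_lt b) hab)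

theorem phase_mem (hζ : IsPrimitiveRoot ζ (dbar d)) (a : ZMod d) :
    phase hζ a ∈ Subgroup.zpowers ζ :=
  Subgroup.pow_mem _ (Subgroup.pow_mem _ (Subgroup.mem_zpowers ζ) 2) _

/-- `g = ζ^c ∏_r Z_r^{b_r} · ∏_r X_r^{a_r}` for some `c`, where `m = (b, a)`. -/
def HasSymbol (hζ : IsPrimitiveRoot ζ (dbar d)) (g : Qudits d n ≃ₗ[ℂ] Qudits d n)
    (m : SympMod d n) : Prop :=
  ∃ c ∈ Subgroup.zpowers ζ, ∀ (v : Qudits d n) (i : Fin n → ZMod d),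
    g v i = ((c * phase hζ (m.1 ⬝ᵥ i) : ℂˣ) : ℂ) * v (i - m.2)

variable (hζ : IsPrimitiveRoot ζ (dbar d))

theorem HasSymbol.mul {g g' : Qudits d n ≃ₗ[ℂ] Qudits d n} {m m' : SympMod d n}
    (h : HasSymbol hζ g m) (h' : HasSymbol hζ g' m') : HasSymbol hζ (g * g') (m + m') := by
  obtain ⟨c, hc, hg⟩ := h
  obtain ⟨c', hc', hg'⟩ := h'
  refine ⟨c * c' * phase hζ (-(m'.1 ⬝ᵥ m.2)),
    mul_mem (mul_mem hc hc') (phase_mem hζ _), fun v i => ?_⟩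
  rw [LinearEquiv.mul_apply, hg, hg', ← mul_assoc, ← Units.val_mul]
  have h1 : i - m.2 - m'.2 = i - (m + m').2 := by simp [sub_sub]
  have h2 : phase hζ (m'.1 ⬝ᵥ (i - m.2)) =
      phase hζ (m'.1 ⬝ᵥ i) * phase hζ (-(m'.1 ⬝ᵥ m.2)) := by
    rw [← AddChar.map_add_eq_mul, dotProduct_sub, sub_eq_add_neg]
  have h3 : phase hζ ((m + m').1 ⬝ᵥ i) = phase hζ (m.1 ⬝ᵥ i) * phase hζ (m'.1 ⬝ᵥ i) := by
    rw [← AddChar.map_add_eq_mul, Prod.fst_add, add_dotProduct]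
  rw [h1, h2, h3]
  congr 2
  ac_rfl

theorem HasSymbol.inv {g : Qudits d n ≃ₗ[ℂ] Qudits d n} {m : SympMod d n}
    (h : HasSymbol hζ g m) : HasSymbol hζ g⁻¹ (-m) := by
  obtain ⟨c, hc, hg⟩ := h
  refine ⟨c⁻¹ * phase hζ (-(m.1 ⬝ᵥ m.2)), mul_mem (inv_mem hc) (phase_mem hζ _), fun v i => ?_⟩
  have h1 := hg (g⁻¹ v) (i + m.2)
  have h2 : g (g⁻¹ v) = v := g.apply_symm_apply v
  rw [h2, add_sub_cancel_right] at h1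
  have h3 : i - (-m).2 = i + m.2 := by simp
  rw [h3, h1, ← mul_assoc, ← Units.val_mul, Prod.fst_neg]
  have h4 : c⁻¹ * phase hζ (-(m.1 ⬝ᵥ m.2)) * phase hζ (-m.1 ⬝ᵥ i) *
      (c * phase hζ (m.1 ⬝ᵥ (i + m.2))) = 1 := by
    have h5 : phase hζ (-(m.1 ⬝ᵥ m.2)) * phase hζ (-m.1 ⬝ᵥ i) *
        phase hζ (m.1 ⬝ᵥ (i + m.2)) = 1 := by
      rw [← AddChar.map_add_eq_mul, ← AddChar.map_add_eq_mul, neg_dotProduct, dotProduct_add]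
      simp
    calc _ = (c⁻¹ * c) * (phase hζ (-(m.1 ⬝ᵥ m.2)) * phase hζ (-m.1 ⬝ᵥ i) *
        phase hζ (m.1 ⬝ᵥ (i + m.2))) := by
          ac_rfl
      _ = 1 := by rw [h5]; simp
  rw [h4]; simp

theorem hasSymbol_opZ (r : Fin n) : HasSymbol hζ (opZ d n ζ r) (Pi.single r 1, 0) :=
  ⟨1, one_mem _, fun v i => by
    rw [opZ_apply]; simp [phase, AddChar.zmodChar_apply]⟩

theorem hasSymbol_opX (r : Fin n) : HasSymbol hζ (opX d n r) (0, Pi.single r 1) :=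
  ⟨1, one_mem _, fun v i => by rw [opX_apply]; simp⟩

theorem hasSymbol_opScalar : HasSymbol hζ (opScalar d n ζ) 0 :=
  ⟨ζ, Subgroup.mem_zpowers ζ, fun v i => by rw [opScalar_apply]; simp⟩

theorem hasSymbol_one : HasSymbol hζ (1 : Qudits d n ≃ₗ[ℂ] Qudits d n) 0 :=
  ⟨1, one_mem _, fun v i => by simp⟩

theorem exists_hasSymbol (g : Pauli d n ζ) : ∃ m, HasSymbol hζ (g : Qudits d n ≃ₗ[ℂ] _) m := by
  obtain ⟨g, hg⟩ := g
  induction hg using Subgroup.closure_induction with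
  | mem x hx =>
    rcases hx with (⟨r, rfl⟩ | ⟨r, rfl⟩) | rfl
    · exact ⟨_, hasSymbol_opX hζ r⟩
    · exact ⟨_, hasSymbol_opZ hζ r⟩
    · exact ⟨_, hasSymbol_opScalar hζ⟩
  | one => exact ⟨_, hasSymbol_one hζ⟩
  | mul x y _ _ hx hy =>
    obtain ⟨m, hm⟩ := hx
    obtain ⟨m', hm'⟩ := hy
    exact ⟨_, hm.mul hζ hm'⟩
  | inv x _ hx =>
    obtain ⟨m, hm⟩ := hx
    exact ⟨_, hm.inv hζ⟩

theorem HasSymbol.unique {g : Qudits d n ≃ₗ[ℂ] Qudits d n} {m m' : SympMod d n}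
    (h : HasSymbol hζ g m) (h' : HasSymbol hζ g m') : m = m' := by
  obtain ⟨c, -, hg⟩ := h
  obtain ⟨c', -, hg'⟩ := h'
  have hx : m.2 = m'.2 := by
    by_contra hne
    have h1 := hg (EuclideanSpace.single 0 1) m.2
    rw [hg' (EuclideanSpace.single 0 1) m.2] at h1
    have h2 : m.2 - m'.2 ≠ 0 := sub_ne_zero.mpr hne
    simp [h2] at h1
  have key : ∀ i : Fin n → ZMod d, c' * phase hζ (m'.1 ⬝ᵥ i) = c * phase hζ (m.1 ⬝ᵥ i) := by
    intro i
    have h1 := hg (EuclideanSpace.single (i - m.2) 1) i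
    rw [hg' (EuclideanSpace.single (i - m.2) 1) i, ← hx] at h1
    refine Units.ext ?_
    simpa using h1
  have hc : c' = c := by simpa using key 0
  subst hc
  refine Prod.ext (funext fun r => ?_) hx
  have h1 := phase_injective hζ (mul_left_cancel (key (Pi.single r 1)))
  simpa using h1.symm

/-- The homomorphism `τ : P_n → M` with `Z_r ↦ z_r`, `X_r ↦ x_r`, `ζ ↦ 0`, that is, the quotient map
`P_n → P_n / ⟨ζ⟩` followed by the isomorphism `P_n / ⟨ζ⟩ ≃ M`. -/
def tau : Pauli d n ζ →* Multiplicative (SympMod d n) where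
  toFun g := Multiplicative.ofAdd (exists_hasSymbol hζ g).choose
  map_one' := congrArg Multiplicative.ofAdd
    ((exists_hasSymbol hζ (1 : Pauli d n ζ)).choose_spec.unique hζ (hasSymbol_one hζ))
  map_mul' g g' := congrArg Multiplicative.ofAdd
    ((exists_hasSymbol hζ (g * g')).choose_spec.unique hζ
      ((exists_hasSymbol hζ g).choose_spec.mul hζ (exists_hasSymbol hζ g').choose_spec))

theorem tau_eq_iff (g : Pauli d n ζ) (m : SympMod d n) :
    tau hζ g = Multiplicative.ofAdd m ↔ HasSymbol hζ (g : Qudits d n ≃ₗ[ℂ] _) m :=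
  ⟨fun h => (Multiplicative.ofAdd.injective h) ▸ (exists_hasSymbol hζ g).choose_spec,
    fun h => congrArg Multiplicative.ofAdd ((exists_hasSymbol hζ g).choose_spec.unique hζ h)⟩

theorem tau_pauliZ (r : Fin n) :
    tau hζ (pauliZ d n ζ r) = Multiplicative.ofAdd (Pi.single r 1, 0) :=
  (tau_eq_iff hζ _ _).mpr (hasSymbol_opZ hζ r)

theorem tau_pauliX (r : Fin n) :
    tau hζ (pauliX d n ζ r) = Multiplicative.ofAdd (0, Pi.single r 1) :=
  (tau_eq_iff hζ _ _).mpr (hasSymbol_opX hζ r)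

theorem tau_ker : (tau hζ : Pauli d n ζ →* _).ker = Subgroup.zpowers (pauliScalar d n ζ) := by
  apply le_antisymm
  · intro g hg
    obtain ⟨c, hc, h⟩ := (tau_eq_iff hζ g 0).mp hg
    obtain ⟨k, rfl⟩ := Subgroup.mem_zpowers_iff.mp hc
    refine Subgroup.mem_zpowers_iff.mpr ⟨k, Subtype.ext ?_⟩
    have hz : ∀ k : ℤ, opScalar d n ζ ^ k = (LinearEquiv.smulOfUnit (ζ ^ k) : Qudits d n ≃ₗ[ℂ] _) :=
      fun k => (map_zpow (DistribMulAction.toModuleAut ℂ (Qudits d n) (S := ℂˣ)) ζ k).symm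
    change opScalar d n ζ ^ k = (g : Qudits d n ≃ₗ[ℂ] _)
    rw [hz]
    ext v i
    rw [h v i]
    simp [LinearEquiv.smulOfUnit, Units.smul_def]
  · rw [Subgroup.zpowers_le]
    exact (tau_eq_iff hζ _ 0).mpr (hasSymbol_opScalar hζ)

/-- The image `τ(H)`, as a submodule of `M`. -/
def tauImage (H : Subgroup (Pauli d n ζ)) : Submodule (ZMod d) (SympMod d n) where
  carrier := {m | ∃ h ∈ H, tau hζ h = Multiplicative.ofAdd m}
  zero_mem' := ⟨1, one_mem H, map_one _⟩
  add_mem' := by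
    rintro m m' ⟨h, hh, hm⟩ ⟨h', hh', hm'⟩
    exact ⟨h * h', mul_mem hh hh', by rw [map_mul, hm, hm', ofAdd_add]⟩
  smul_mem' := by
    rintro c m ⟨h, hh, hm⟩
    refine ⟨h ^ c.val, pow_mem hh _, ?_⟩
    rw [map_pow, hm, ← ofAdd_nsmul]
    congr 1
    rw [← Nat.cast_smul_eq_nsmul (ZMod d), ZMod.natCast_val, ZMod.cast_id', id]

/-! ### Symplectic bases, shifts, shifted free subgroups -/

/-- `(e_1, …, e_n, f_1, …, f_n)` is a symplectic basis of `M`. -/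
structure IsSymplecticBasis (e f : Fin n → SympMod d n) : Prop where
  linearIndependent : LinearIndependent (ZMod d) (Sum.elim e f)
  span_eq_top : Submodule.span (ZMod d) (Set.range (Sum.elim e f)) = ⊤
  form_ee : ∀ i j, sympForm d n (e i) (e j) = 0
  form_ff : ∀ i j, sympForm d n (f i) (f j) = 0
  form_ef : ∀ i j, sympForm d n (e i) (f j) = if i = j then 1 else 0

/-- `Z'_1, …, Z'_n, X'_1, …, X'_n` satisfy the relations of the standard generators of `P_n`
(the relations that involve `ζ` alone, or say that `ζ` is central, hold automatically). -/
structure PauliRelations (Z' X' : Fin n → Pauli d n ζ) : Prop where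
  comm_XX : ∀ k r, X' k * X' r = X' r * X' k
  comm_ZZ : ∀ k r, Z' k * Z' r = Z' r * Z' k
  comm_XZ : ∀ k r, r ≠ k → X' k * Z' r = Z' r * X' k
  comm_ZX : ∀ k, Z' k * X' k = pauliScalar d n ζ ^ 2 * (X' k * Z' k)
  pow_X : ∀ k, X' k ^ d = 1
  pow_Z : ∀ k, Z' k ^ d = 1

/-- `H` is abelian and contains no scalar `ζ^a` except the identity. -/
structure IsStabilizer (H : Subgroup (Pauli d n ζ)) : Prop where
  comm : ∀ x ∈ H, ∀ y ∈ H, x * y = y * x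
  no_scalar : H ⊓ Subgroup.zpowers (pauliScalar d n ζ) = ⊥

/-- `H` is a shift of the subgroup `H'` of rank `k`: for some symplectic basis `(e, f)` of `M` such
that `e_1, …, e_k` is a basis of `τ(H')`, some lifts `Z'`, `X'` of it satisfying the Pauli relations,
with `H' = ⟨Z'_1, …, Z'_k⟩`, and some divisors `a_1, …, a_k` of `d`,
`H = ⟨Z'_1^{a_1}, …, Z'_k^{a_k}, X'_1^{d/a_1}, …, X'_k^{d/a_k}⟩`. -/
def IsShift {k : ℕ} (hk : k ≤ n) (H H' : Subgroup (Pauli d n ζ)) : Prop :=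
  ∃ (e f : Fin n → SympMod d n) (Z' X' : Fin n → Pauli d n ζ) (a : Fin k → ℕ),
    IsSymplecticBasis e f ∧
    Submodule.span (ZMod d) (Set.range fun r : Fin k => e (Fin.castLE hk r)) = tauImage hζ H' ∧
    (∀ r, tau hζ (Z' r) = Multiplicative.ofAdd (e r)) ∧
    (∀ r, tau hζ (X' r) = Multiplicative.ofAdd (f r)) ∧
    PauliRelations Z' X' ∧
    H' = Subgroup.closure (Set.range fun r : Fin k => Z' (Fin.castLE hk r)) ∧
    (∀ r, a r ∣ d) ∧
    H = Subgroup.closure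
      ((Set.range fun r : Fin k => Z' (Fin.castLE hk r) ^ a r) ∪
        (Set.range fun r : Fin k => X' (Fin.castLE hk r) ^ (d / a r)))

/-- `H` is shifted free: it is a shift of an abelian subgroup `H'` without non-trivial scalars with
`H' ≃ (ℤ/d)^k`. -/
def IsShiftedFree (H : Subgroup (Pauli d n ζ)) : Prop :=
  ∃ (k : ℕ) (hk : k ≤ n) (H' : Subgroup (Pauli d n ζ)),
    IsStabilizer H' ∧ Nonempty (H' ≃* Multiplicative (Fin k → ZMod d)) ∧ IsShift hζ hk H H'

end Tau

/-- `L` is a Lagrangian inside some free symplectic submodule `N` of `M`: `N` is free,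
`N ∩ N^⊥ = 0`, `L ⊆ N`, and `L` is its own orthogonal within `N`. -/
def IsLagrangianInFreeSymplectic {d n : ℕ} (L : Submodule (ZMod d) (SympMod d n)) : Prop :=
  ∃ N : Submodule (ZMod d) (SympMod d n), Module.Free (ZMod d) N ∧
    N ⊓ N.orthogonalBilin (sympForm d n) = ⊥ ∧ L ≤ N ∧ L = N ⊓ L.orthogonalBilin (sympForm d n)

/-! ### The stabiliser subspace and the action of `N(H)/H` -/

section Action

variable {d n : ℕ} [NeZero d] {ζ : ℂˣ}

/-- `V^H`, the subspace of vectors fixed by `H`. -/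
def fixedSpace (H : Subgroup (Pauli d n ζ)) : Submodule ℂ (Qudits d n) where
  carrier := {v | ∀ h ∈ H, (h : Qudits d n ≃ₗ[ℂ] Qudits d n) v = v}
  zero_mem' h _ := map_zero _
  add_mem' hv hw h hh := by rw [map_add, hv h hh, hw h hh]
  smul_mem' c v hv h hh := by rw [map_smul, hv h hh]

/-- `N(H)/H`, with `N(H)` the normaliser of `H` in the Pauli group. -/
abbrev NormQuot (H : Subgroup (Pauli d n ζ)) : Type :=
  Subgroup.normalizer (H : Set (Pauli d n ζ)) ⧸
    H.subgroupOf (Subgroup.normalizer (H : Set (Pauli d n ζ)))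

theorem normalizer_apply_mem (H : Subgroup (Pauli d n ζ)) {g : Pauli d n ζ}
    (hg : g ∈ Subgroup.normalizer (H : Set (Pauli d n ζ))) {v : Qudits d n}
    (hv : v ∈ fixedSpace H) : (g : Qudits d n ≃ₗ[ℂ] Qudits d n) v ∈ fixedSpace H := by
  intro h hh
  have h1 : g⁻¹ * h * g ∈ H := (Subgroup.mem_set_normalizer_iff''.mp hg h).mp hh
  have h2 := hv _ h1
  have h3 : h * g = g * (g⁻¹ * h * g) := by group
  calc (h : Qudits d n ≃ₗ[ℂ] Qudits d n) ((g : Qudits d n ≃ₗ[ℂ] Qudits d n) v)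
      = ((h * g : Pauli d n ζ) : Qudits d n ≃ₗ[ℂ] Qudits d n) v := rfl
    _ = (g : Qudits d n ≃ₗ[ℂ] Qudits d n)
          (((g⁻¹ * h * g : Pauli d n ζ) : Qudits d n ≃ₗ[ℂ] Qudits d n) v) := by rw [h3]; rfl
    _ = _ := by rw [h2]

/-- The action of `N(H)` on `V^H`. -/
def normalizerRep (H : Subgroup (Pauli d n ζ)) :
    Representation ℂ (Subgroup.normalizer (H : Set (Pauli d n ζ))) (fixedSpace H) where
  toFun g := ((g : Pauli d n ζ) : Qudits d n ≃ₗ[ℂ] Qudits d n).toLinearMap.restrict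
    fun _ hv => normalizer_apply_mem H g.2 hv
  map_one' := rfl
  map_mul' _ _ := rfl

/-- The action of `N(H)/H` on `V^H` induced by the action of `N(H)`. -/
def quotRep (H : Subgroup (Pauli d n ζ)) : Representation ℂ (NormQuot H) (fixedSpace H) :=
  QuotientGroup.lift _ (normalizerRep H) fun g hg =>
    LinearMap.ext fun v => Subtype.ext (v.2 g (Subgroup.mem_subgroupOf.mp hg))

theorem quotRep_mk_apply (H : Subgroup (Pauli d n ζ))
    (g : Subgroup.normalizer (H : Set (Pauli d n ζ))) (v : fixedSpace H) :
    (quotRep H (QuotientGroup.mk g) v : Qudits d n) =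
      ((g : Pauli d n ζ) : Qudits d n ≃ₗ[ℂ] Qudits d n) v := rfl

end Action

end QuditPauli

end

/-! Put L = τ(H); it is isotropic because H is abelian. Commutators of Pauli operators are the
powers of ξ given by φ (`mul_eq_scalar_mul`), so N(H) is the preimage of L^⊥, and the centre of
N(H)/H consists of the classes with symbol in L^⊥⊥ = L. All three conditions are compared with a
fourth one, `HasSymplecticComplement`: L^⊥ = L + F, where F has a symplectic basis of j pairs.

From (a): an abstract isomorphism of N(H)/H with P_j matches the centres, so L^⊥/L is isomorphic to
the free module of rank 2j. Hence L splits off from L^⊥, and any complement F is automatically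
nondegenerate. From (c): F = N^⊥ works. To (b): L is Lagrangian in F^⊥, the structure theorem
`exists_split_basis` gives it generators a_i e_i and (d/a_i) f_i, and `exists_lift` finds Pauli
lifts adapted to H. From (b) to (c) is a direct computation.

The structure theorem splits off one hyperbolic pair at a time, chosen by means of the exponent of
L. For composite d a direct summand of a free module need not be free, so rank is measured by
counting torsion (`TorsionRank`), which cancels in direct sums.

Back to (a), with equivariance, the argument is of Stone–von Neumann type. Traces give |H| · dim V^H
= d^n, hence dim V^H = d^j. A unit vector fixed by H and by lifts of the e_r, moved around by lifts
of the f_r, yields an orthonormal basis of V^H on which N(H)/H acts through the standard generators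
of P_j. -/

namespace QuditPauli

/-! ### Counting in finite ℤ/d-modules -/

section Counting

-- The inner sum is a character sum over B: it is |B| if `β a` vanishes and 0 otherwise.
open Classical in
theorem sum_stdAddChar_pairing {d : ℕ} [NeZero d] {A B : Type*} [AddCommGroup A] [AddCommGroup B]
    [Fintype A] [Fintype B] (β : A →+ B →+ ZMod d) :
    ∑ a, ∑ b, ZMod.stdAddChar (β a b) =
      ((Nat.card B * Nat.card {a // ∀ b, β a b = 0} : ℕ) : ℂ) := by
  have h : ∀ a, ∑ b, ZMod.stdAddChar (β a b) =
      if ∀ b, β a b = 0 then (Fintype.card B : ℂ) else 0 := by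
    intro a
    have := AddChar.sum_eq_ite ((ZMod.stdAddChar (N := d)).compAddMonoidHom (β a))
    simp only [AddChar.compAddMonoidHom_apply] at this
    rw [this]
    refine if_congr ⟨fun h b => ?_, fun h => ?_⟩ rfl rfl
    · apply ZMod.injective_stdAddChar
      simpa using DFunLike.congr_fun h b
    · ext b
      simp [h b]
  simp_rw [h, Finset.sum_ite, Finset.sum_const_zero, Finset.sum_const, add_zero,
    Nat.card_eq_fintype_card, Fintype.card_subtype]
  simp [mul_comm]

/-- For a pairing of finite groups with values in `ℤ/d`, `|B|·|ker_left| = |A|·|ker_right|`. -/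
theorem card_mul_card_leftKernel {d : ℕ} [NeZero d] {A B : Type*} [AddCommGroup A] [AddCommGroup B]
    [Finite A] [Finite B] (β : A →+ B →+ ZMod d) :
    Nat.card B * Nat.card {a // ∀ b, β a b = 0} =
      Nat.card A * Nat.card {b // ∀ a, β a b = 0} := by
  have := Fintype.ofFinite A
  have := Fintype.ofFinite B
  -- The same double sum is evaluated in both orders of summation.
  have h1 := sum_stdAddChar_pairing β
  have h2 := sum_stdAddChar_pairing β.flip
  rw [Finset.sum_comm] at h2
  simp only [AddMonoidHom.flip_apply] at h2
  exact_mod_cast h1.symm.trans h2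

/-- The `c`-torsion of `A` has `c ^ r` elements for all `c ∣ d`, as for a free `ℤ/d`-module of
rank `r`. -/
def TorsionRank (d : ℕ) (A : Type*) [AddCommGroup A] (r : ℕ) : Prop :=
  ∀ c, c ∣ d → Nat.card {x : A // c • x = 0} = c ^ r

theorem TorsionRank.congr {d r : ℕ} {A B : Type*} [AddCommGroup A] [AddCommGroup B] (e : A ≃+ B)
    (h : TorsionRank d A r) : TorsionRank d B r := by
  intro c hc
  rw [← h c hc]
  refine (Nat.card_congr (e.toEquiv.subtypeEquiv fun x => ?_)).symm
  change _ ↔ c • e x = 0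
  rw [← map_nsmul, map_eq_zero_iff e e.injective]

/-- Torsion counts are multiplicative, so a factor can be divided out. Freeness itself would not
pass to the other factor in this way. The comparison of r with s uses c = d > 1. -/
theorem TorsionRank.of_prod {d r s : ℕ} (hd : 1 < d) {A B : Type*} [AddCommGroup A] [AddCommGroup B]
    (hA : TorsionRank d A r) (h : TorsionRank d (A × B) s) :
    r ≤ s ∧ TorsionRank d B (s - r) := by
  have key : ∀ c, c ∣ d → c ^ r * Nat.card {x : B // c • x = 0} = c ^ s := by
    intro c hc
    rw [← hA c hc, ← h c hc, ← Nat.card_prod]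
    refine Nat.card_congr ((Equiv.subtypeProdEquivProd (p := fun x : A => c • x = 0)
      (q := fun x : B => c • x = 0)).symm.trans (Equiv.subtypeEquivRight fun x => ?_))
    simp [Prod.ext_iff]
  have hrs : r ≤ s := (Nat.pow_dvd_pow_iff_le_right hd).mp (Dvd.intro _ (key d dvd_rfl))
  refine ⟨hrs, fun c hc => ?_⟩
  have hc0 : 0 < c := Nat.pos_of_dvd_of_pos hc (by omega)
  have := key c hc
  rw [← Nat.add_sub_of_le hrs, pow_add] at this
  exact Nat.eq_of_mul_eq_mul_left (pow_pos hc0 r) this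

theorem card_nsmul_ker_mul_card_range {A : Type*} [AddCommGroup A] (c : ℕ) :
    Nat.card {x : A // c • x = 0} * Nat.card (nsmulAddMonoidHom (α := A) c).range =
      Nat.card A := by
  rw [← AddSubgroup.index_ker, ← AddSubgroup.card_mul_index (nsmulAddMonoidHom (α := A) c).ker]
  rfl

theorem torsionRank_zmod (d : ℕ) [NeZero d] : TorsionRank d (ZMod d) 1 := by
  intro c hc
  rw [pow_one]
  refine (IsAddCyclic.card_nsmulAddMonoidHom_ker (G := ZMod d) c).trans ?_
  rw [Nat.card_zmod]
  exact Nat.gcd_eq_right hc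

theorem torsionRank_pi (d : ℕ) [NeZero d] (ι : Type*) [Fintype ι] :
    TorsionRank d (ι → ZMod d) (Fintype.card ι) := by
  intro c hc
  have e : {x : ι → ZMod d // c • x = 0} ≃ (ι → {x : ZMod d // c • x = 0}) :=
    (Equiv.subtypeEquivRight fun x => by simp [funext_iff]).trans
      (Equiv.subtypePiEquivPi (p := fun _ (x : ZMod d) => c • x = 0))
  rw [Nat.card_congr e, Nat.card_fun, torsionRank_zmod d c hc, pow_one, Nat.card_eq_fintype_card]

theorem TorsionRank.card_eq {d r : ℕ} {A : Type*} [AddCommGroup A] [Module (ZMod d) A]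
    (h : TorsionRank d A r) : Nat.card A = d ^ r := by
  rw [← h d dvd_rfl]
  refine Nat.card_congr (Equiv.subtypeUnivEquiv fun x => ?_).symm
  rw [← Nat.cast_smul_eq_nsmul (ZMod d)]
  simp

/-- If `a * m = d`, the `m`-torsion consists of the multiples of `a`. -/
theorem TorsionRank.exists_nsmul_eq {d r : ℕ} [NeZero d] {A : Type*} [AddCommGroup A]
    [Module (ZMod d) A] [Finite A]
    (h : TorsionRank d A r) {a m : ℕ} (ham : a * m = d) {x : A} (hx : m • x = 0) :
    ∃ y, a • y = x := by
  -- Since |A| = d^r and |A[a]| = a^r, the image aA has m^r elements, as many as A[m], which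
  -- contains it.
  have h1 := card_nsmul_ker_mul_card_range (A := A) a
  rw [h a ⟨m, ham.symm⟩, h.card_eq, ← ham, mul_pow] at h1
  have ha : 0 < a := Nat.pos_of_mul_pos_right (ham ▸ NeZero.pos d)
  have h2 := Nat.eq_of_mul_eq_mul_left (pow_pos ha r) h1
  have h3 : (nsmulAddMonoidHom (α := A) a).range ≤ (nsmulAddMonoidHom (α := A) m).ker := by
    rintro _ ⟨y, rfl⟩
    rw [AddMonoidHom.mem_ker, nsmulAddMonoidHom_apply, nsmulAddMonoidHom_apply, smul_smul,
      mul_comm, ham, ← Nat.cast_smul_eq_nsmul (ZMod d)]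
    simp
  have h4 := AddSubgroup.eq_of_le_of_card_ge h3 (by
    rw [h2, ← h m ⟨a, by rw [← ham, mul_comm]⟩]; exact le_rfl)
  have : x ∈ (nsmulAddMonoidHom (α := A) a).range := by rw [h4]; exact hx
  exact this

end Counting
-- Orthogonals and symplectic families
section Symplectic

variable {d n : ℕ}

theorem sympForm_apply (x y : SympMod d n) :
    sympForm d n x y = x.1 ⬝ᵥ y.2 - x.2 ⬝ᵥ y.1 := rfl

theorem sympForm_self (x : SympMod d n) : sympForm d n x x = 0 := by
  rw [sympForm_apply, dotProduct_comm, sub_self]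

theorem sympForm_swap (x y : SympMod d n) : sympForm d n x y = -sympForm d n y x := by
  rw [sympForm_apply, sympForm_apply, dotProduct_comm, dotProduct_comm x.2, neg_sub]

theorem sympForm_eq_zero_comm {x y : SympMod d n} :
    sympForm d n x y = 0 ↔ sympForm d n y x = 0 := by
  rw [sympForm_swap, neg_eq_zero]

theorem eq_zero_of_sympForm_eq_zero {x : SympMod d n} (h : ∀ y, sympForm d n x y = 0) : x = 0 := by
  refine Prod.ext (funext fun i => ?_) (funext fun i => ?_)
  · simpa [sympForm_apply] using h (0, Pi.single i 1)
  · simpa [sympForm_apply] using h (Pi.single i 1, 0)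

/-- The orthogonal of a submodule of `M`. -/
abbrev orth (N : Submodule (ZMod d) (SympMod d n)) : Submodule (ZMod d) (SympMod d n) :=
  N.orthogonalBilin (sympForm d n)

variable {N L : Submodule (ZMod d) (SympMod d n)}

theorem mem_orth {x : SympMod d n} : x ∈ orth N ↔ ∀ y ∈ N, sympForm d n x y = 0 := by
  simp_rw [Submodule.mem_orthogonalBilin_iff, sympForm_eq_zero_comm (y := x)]

theorem orth_anti {N N' : Submodule (ZMod d) (SympMod d n)} (h : N ≤ N') : orth N' ≤ orth N :=
  fun _ hx => mem_orth.mpr fun y hy => mem_orth.mp hx y (h hy)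

theorem le_orth_orth : N ≤ orth (orth N) :=
  fun _ hx => mem_orth.mpr fun _ hy => sympForm_eq_zero_comm.mp (mem_orth.mp hy _ hx)

theorem orth_top : orth (⊤ : Submodule (ZMod d) (SympMod d n)) = ⊥ :=
  (Submodule.eq_bot_iff _).mpr fun _ hx =>
    eq_zero_of_sympForm_eq_zero fun y => mem_orth.mp hx y trivial

/-- In the pairing of L with N, the left kernel is zero because N is nondegenerate, and the right
kernel is N ∩ L^⊥. -/
theorem card_eq_card_mul_card_orth [NeZero d] (hN : N ⊓ orth N = ⊥) (hL : L ≤ N) :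
    Nat.card N = Nat.card L * Nat.card (N ⊓ orth L : Submodule (ZMod d) (SympMod d n)) := by
  let β : L →+ N →+ ZMod d :=
    AddMonoidHom.mk' (fun x => ((sympForm d n x.1).comp N.subtype).toAddMonoidHom) fun x y => by
      ext z
      simp
  have h1 := card_mul_card_leftKernel β
  have h2 : Nat.card {a : L // ∀ b, β a b = 0} = 1 := by
    rw [Nat.card_eq_one_iff_unique]
    refine ⟨⟨fun x y => ?_⟩, ⟨⟨0, fun b => by simp⟩⟩⟩
    have h0 : ∀ x : {a : L // ∀ b, β a b = 0}, x.1.1 = 0 := fun x => by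
      have : x.1.1 ∈ N ⊓ orth N := ⟨hL x.1.2, mem_orth.mpr fun y hy => x.2 ⟨y, hy⟩⟩
      rwa [hN] at this
    exact Subtype.ext (Subtype.ext ((h0 x).trans (h0 y).symm))
  have h3 : Nat.card {b : N // ∀ a, β a b = 0} =
      Nat.card (N ⊓ orth L : Submodule (ZMod d) (SympMod d n)) := by
    refine Nat.card_congr
      { toFun := fun x => ⟨x.1.1, x.1.2, fun y hy => x.2 ⟨y, hy⟩⟩
        invFun := fun x => ⟨⟨x.1, x.2.1⟩, fun y => x.2.2 y.1 y.2⟩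
        left_inv := fun _ => rfl
        right_inv := fun _ => rfl }
  rw [h2, mul_one, h3] at h1
  exact h1

theorem card_sympMod (d n : ℕ) : Nat.card (SympMod d n) = d ^ (2 * n) := by
  rw [Nat.card_prod, Nat.card_fun, Nat.card_zmod, Nat.card_fin, two_mul, pow_add]

theorem card_mul_card_orth [NeZero d] (L : Submodule (ZMod d) (SympMod d n)) :
    Nat.card L * Nat.card (orth L) = d ^ (2 * n) := by
  have h := card_eq_card_mul_card_orth (N := ⊤) (L := L) (by rw [orth_top, inf_bot_eq]) le_top
  rw [top_inf_eq] at h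
  rw [← h, ← card_sympMod d n]
  exact Nat.card_congr (Equiv.Set.univ _)

/-- One inclusion is formal; the orders agree because |N| |N^⊥| = |M| = |N^⊥| |N^⊥⊥|. -/
theorem orth_orth [NeZero d] : orth (orth N) = N := by
  have h := card_mul_card_orth N
  rw [← card_mul_card_orth (orth N), mul_comm] at h
  have h0 : 0 < Nat.card (orth N) := Nat.card_pos
  have h1 := Nat.eq_of_mul_eq_mul_left h0 h
  refine (SetLike.coe_injective (Set.eq_of_subset_of_ncard_le le_orth_orth ?_)).symm
  rw [← Nat.card_coe_set_eq, ← Nat.card_coe_set_eq]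
  exact h1.ge

/-- A nondegenerate submodule contains a Lagrangian. -/
theorem exists_lagrangian [NeZero d] (N : Submodule (ZMod d) (SympMod d n)) :
    ∃ L, L = N ⊓ orth L := by
  obtain ⟨L, hL⟩ := Set.Finite.exists_maximal
    (s := {L : Submodule (ZMod d) (SympMod d n) | L ≤ N ⊓ orth L}) (Set.toFinite _)
    ⟨⊥, (bot_le : ⊥ ≤ N ⊓ orth ⊥)⟩
  refine ⟨L, le_antisymm hL.1 fun x hx => ?_⟩
  replace hL : L ≤ N ⊓ orth L ∧ ∀ ⦃L'⦄, L' ≤ N ⊓ orth L' → L ≤ L' → L' ≤ L := hL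
  -- As φ is alternating, adjoining to L a vector of N ∩ L^⊥ keeps it isotropic; maximality then
  -- puts that vector in L.
  have h1 : L ⊔ Submodule.span _ {x} ≤ N ⊓ orth (L ⊔ Submodule.span _ {x}) := by
    refine le_inf (sup_le (hL.1.trans inf_le_left) ?_) ?_
    · rw [Submodule.span_singleton_le_iff_mem]
      exact hx.1
    · intro y hy
      refine mem_orth.mpr fun z hz => ?_
      obtain ⟨y1, hy1, y2, hy2, rfl⟩ := Submodule.mem_sup.mp hy
      obtain ⟨z1, hz1, z2, hz2, rfl⟩ := Submodule.mem_sup.mp hz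
      obtain ⟨s, rfl⟩ := Submodule.mem_span_singleton.mp hy2
      obtain ⟨t, rfl⟩ := Submodule.mem_span_singleton.mp hz2
      have e1 := mem_orth.mp (hL.1 hy1).2 z1 hz1
      have e2 := mem_orth.mp hx.2 z1 hz1
      have e3 := sympForm_eq_zero_comm.mp (mem_orth.mp hx.2 y1 hy1)
      simp [e1, e2, e3, sympForm_self]
  exact hL.2 h1 le_sup_left (Submodule.mem_sup_right (Submodule.mem_span_singleton_self x))

/-- `e_i`, `f_i` satisfy the relations of a symplectic basis. -/
structure IsSymplecticFamily {ι : Type*} [DecidableEq ι] (e f : ι → SympMod d n) : Prop where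
  form_ee : ∀ i j, sympForm d n (e i) (e j) = 0
  form_ff : ∀ i j, sympForm d n (f i) (f j) = 0
  form_ef : ∀ i j, sympForm d n (e i) (f j) = if i = j then 1 else 0

/-- The span of a symplectic family. -/
abbrev famSpan {ι : Type*} (e f : ι → SympMod d n) : Submodule (ZMod d) (SympMod d n) :=
  Submodule.span (ZMod d) (Set.range (Sum.elim e f))

theorem famSpan_le {ι : Type*} {e f : ι → SympMod d n} :
    famSpan e f ≤ N ↔ (∀ i, e i ∈ N) ∧ ∀ i, f i ∈ N := by
  simp [famSpan, Submodule.span_le, Set.range_subset_iff]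

theorem mem_orth_famSpan {ι : Type*} {e f : ι → SympMod d n} {x : SympMod d n} :
    x ∈ orth (famSpan e f) ↔
    (∀ i, sympForm d n x (e i) = 0) ∧ ∀ i, sympForm d n x (f i) = 0 := by
  have : x ∈ orth (famSpan e f) ↔ famSpan e f ≤ LinearMap.ker (sympForm d n x) := mem_orth
  rw [this, famSpan_le]
  rfl

theorem sum_mem_famSpan {ι : Type*} [Fintype ι] (e f : ι → SympMod d n) (a b : ι → ZMod d) :
    ∑ i, a i • e i + ∑ i, b i • f i ∈ famSpan e f :=
  add_mem
    (sum_mem fun i _ => Submodule.smul_mem _ _ (Submodule.subset_span ⟨Sum.inl i, rfl⟩))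
    (sum_mem fun i _ => Submodule.smul_mem _ _ (Submodule.subset_span ⟨Sum.inr i, rfl⟩))

namespace IsSymplecticFamily

variable {ι : Type*} [DecidableEq ι] {e f : ι → SympMod d n} (h : IsSymplecticFamily e f)
include h

theorem form_fe (i j : ι) : sympForm d n (f i) (e j) = if i = j then -1 else 0 := by
  rw [sympForm_swap, h.form_ef]
  split_ifs <;> simp_all

variable [Fintype ι]

theorem linearIndependent : LinearIndependent (ZMod d) (Sum.elim e f) := by
  rw [Fintype.linearIndependent_iff]
  intro g hg
  rw [Fintype.sum_sum_type] at hg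
  rintro (i | i)
  · simpa [h.form_ff, h.form_fe] using congrArg (sympForm d n (f i)) hg
  · simpa [h.form_ee, h.form_ef] using congrArg (sympForm d n (e i)) hg

/-- Removing the component of a vector in the span of the family leaves a vector orthogonal to it. -/
theorem exists_sub_mem_orth (x : SympMod d n) :
    x - (∑ i, sympForm d n x (f i) • e i + ∑ i, sympForm d n (e i) x • f i) ∈
      orth (famSpan e f) := by
  refine mem_orth_famSpan.mpr ⟨fun j => ?_, fun j => ?_⟩
  · simp [h.form_ee, h.form_fe, sympForm_swap (e j) x]
  · simp [h.form_ff, h.form_ef]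

theorem famSpan_inf_orth : famSpan e f ⊓ orth (famSpan e f) = ⊥ := by
  rw [Submodule.eq_bot_iff]
  rintro x ⟨hx, hx'⟩
  obtain ⟨c, rfl⟩ := (Submodule.mem_span_range_iff_exists_fun _).mp hx
  obtain ⟨h1, h2⟩ := mem_orth_famSpan.mp hx'
  have h3 : ∀ i, c i = 0 := by
    rw [Fintype.sum_sum_type] at h1 h2
    rintro (i | i)
    · simpa [h.form_ff, h.form_ef] using h2 i
    · simpa [h.form_ee, h.form_fe] using h1 i
  simp [h3]

theorem torsionRank_famSpan [NeZero d] : TorsionRank d (famSpan e f) (2 * Fintype.card ι) := by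
  have e := (Module.Basis.span h.linearIndependent).equivFun
  have := (torsionRank_pi d (ι ⊕ ι)).congr e.symm.toAddEquiv
  rwa [Fintype.card_sum, ← two_mul] at this

theorem exists_add_of_mem (hN : famSpan e f ≤ N) {x : SympMod d n} (hx : x ∈ N) :
    ∃ y ∈ famSpan e f, ∃ z ∈ N ⊓ orth (famSpan e f), y + z = x :=
  ⟨_, sum_mem_famSpan _ _ _ _, _,
    ⟨sub_mem hx (hN (sum_mem_famSpan _ _ _ _)), h.exists_sub_mem_orth x⟩, add_sub_cancel _ _⟩

/-- N is the sum of the span and its orthogonal in N, so a vector in the radical of the latter is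
orthogonal to all of N. -/
theorem inf_orth_inf_orth (hN : N ⊓ orth N = ⊥) (hle : famSpan e f ≤ N) :
    (N ⊓ orth (famSpan e f)) ⊓ orth (N ⊓ orth (famSpan e f)) = ⊥ := by
  rw [Submodule.eq_bot_iff]
  rintro x ⟨⟨hx, hx1⟩, hx2⟩
  have : x ∈ N ⊓ orth N := by
    refine ⟨hx, mem_orth.mpr fun y hy => ?_⟩
    obtain ⟨u, hu, v, hv, rfl⟩ := h.exists_add_of_mem hle hy
    rw [map_add, mem_orth.mp hx1 u hu, mem_orth.mp hx2 v hv, add_zero]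
  rwa [hN] at this

/-- The sum of the span and its orthogonal in N is direct, and the span is free, so its torsion
counts cancel. -/
theorem torsionRank_inf_orth [NeZero d] (hd : 1 < d) (hle : famSpan e f ≤ N) {r : ℕ}
    (hr : TorsionRank d N r) : 2 * Fintype.card ι ≤ r ∧
      TorsionRank d (N ⊓ orth (famSpan e f) : Submodule (ZMod d) (SympMod d n))
        (r - 2 * Fintype.card ι) := by
  let F : famSpan e f × (N ⊓ orth (famSpan e f) : Submodule (ZMod d) (SympMod d n)) →+ N :=
    AddMonoidHom.mk' (fun p => ⟨p.1.1 + p.2.1, add_mem (hle p.1.2) p.2.2.1⟩) fun p q =>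
      Subtype.ext (by simp [add_add_add_comm])
  have hF : Function.Bijective F := by
    refine ⟨(injective_iff_map_eq_zero F).mpr fun p hp => ?_, fun x => ?_⟩
    · have h1 : p.1.1 + p.2.1 = 0 := congrArg Subtype.val hp
      have h2 : p.1.1 ∈ famSpan e f ⊓ orth (famSpan e f) :=
        ⟨p.1.2, by rw [eq_neg_of_add_eq_zero_left h1]; exact neg_mem p.2.2.2⟩
      rw [h.famSpan_inf_orth, Submodule.mem_bot] at h2
      refine Prod.ext (Subtype.ext h2) (Subtype.ext ?_)
      simpa [h2] using h1
    · obtain ⟨y, hy, z, hz, hx⟩ := h.exists_add_of_mem hle x.2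
      exact ⟨(⟨y, hy⟩, ⟨z, hz⟩), Subtype.ext hx⟩
  exact h.torsionRank_famSpan.of_prod hd (hr.congr (AddEquiv.ofBijective F hF).symm)

end IsSymplecticFamily

end Symplectic
-- Split form of a Lagrangian
section SplitLagrangian

variable {d n : ℕ} {N L : Submodule (ZMod d) (SympMod d n)}

theorem modulus_nsmul {A : Type*} [AddCommGroup A] [Module (ZMod d) A] (x : A) : d • x = 0 := by
  rw [← Nat.cast_smul_eq_nsmul (ZMod d), ZMod.natCast_self, zero_smul]

theorem sympForm_nsmul_left (k : ℕ) (x y : SympMod d n) :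
    sympForm d n (k • x) y = k * sympForm d n x y := by
  rw [map_nsmul, LinearMap.smul_apply, nsmul_eq_mul]

theorem sympForm_nsmul_right (k : ℕ) (x y : SympMod d n) :
    sympForm d n x (k • y) = k * sympForm d n x y := by
  rw [map_nsmul, nsmul_eq_mul]

/-- The `a_i`-th multiples of the `e_i` and the `d / a_i`-th multiples of the `f_i`. -/
abbrev shiftSpan {ι : Type*} (e f : ι → SympMod d n) (a : ι → ℕ) :
    Submodule (ZMod d) (SympMod d n) :=
  Submodule.span (ZMod d) ((Set.range fun i => a i • e i) ∪ Set.range fun i => (d / a i) • f i)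

theorem shiftSpan_le {ι : Type*} {e f : ι → SympMod d n} {a : ι → ℕ} :
    shiftSpan e f a ≤ N ↔ (∀ i, a i • e i ∈ N) ∧ ∀ i, (d / a i) • f i ∈ N := by
  simp [shiftSpan, Submodule.span_le, Set.range_subset_iff]

theorem shiftSpan_le_famSpan {ι : Type*} {e f : ι → SympMod d n} {a : ι → ℕ} :
    shiftSpan e f a ≤ famSpan e f :=
  shiftSpan_le.mpr ⟨fun i => nsmul_mem ((famSpan_le.mp le_rfl).1 i) _,
    fun i => nsmul_mem ((famSpan_le.mp le_rfl).2 i) _⟩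

section Glue

variable {ι κ : Type*} {e f : ι → SympMod d n} {a : ι → ℕ} {e' f' : κ → SympMod d n} {a' : κ → ℕ}

theorem famSpan_sumElim :
    famSpan (Sum.elim e e') (Sum.elim f f') = famSpan e f ⊔ famSpan e' f' := by
  refine eq_of_forall_ge_iff fun N => ?_
  simp only [famSpan_le, sup_le_iff, Sum.forall, Sum.elim_inl, Sum.elim_inr]
  tauto

theorem shiftSpan_sumElim :
    shiftSpan (Sum.elim e e') (Sum.elim f f') (Sum.elim a a') =
      shiftSpan e f a ⊔ shiftSpan e' f' a' := by
  refine eq_of_forall_ge_iff fun N => ?_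
  simp only [shiftSpan_le, sup_le_iff, Sum.forall, Sum.elim_inl, Sum.elim_inr]
  tauto

theorem famSpan_comp (g : κ ≃ ι) : famSpan (e ∘ g) (f ∘ g) = famSpan e f := by
  refine eq_of_forall_ge_iff fun N => ?_
  simp only [famSpan_le, Function.comp_apply, g.forall_congr_left, Equiv.apply_symm_apply]

theorem shiftSpan_comp (g : κ ≃ ι) : shiftSpan (e ∘ g) (f ∘ g) (a ∘ g) = shiftSpan e f a := by
  refine eq_of_forall_ge_iff fun N => ?_
  simp only [shiftSpan_le, Function.comp_apply, g.forall_congr_left, Equiv.apply_symm_apply]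

variable [DecidableEq ι] [DecidableEq κ]

theorem IsSymplecticFamily.comp (h : IsSymplecticFamily e f) (g : κ ≃ ι) :
    IsSymplecticFamily (e ∘ g) (f ∘ g) :=
  ⟨fun _ _ => h.form_ee _ _, fun _ _ => h.form_ff _ _, fun i j => by simp [h.form_ef]⟩

theorem IsSymplecticFamily.sumElim (h : IsSymplecticFamily e f) (h' : IsSymplecticFamily e' f')
    (ho : famSpan e' f' ≤ orth (famSpan e f)) :
    IsSymplecticFamily (Sum.elim e e') (Sum.elim f f') := by
  obtain ⟨h1, h2⟩ := famSpan_le.mp ho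
  have he := fun j => mem_orth_famSpan.mp (h1 j)
  have hf := fun j => mem_orth_famSpan.mp (h2 j)
  refine ⟨?_, ?_, ?_⟩
  · rintro (i | i) (j | j)
    exacts [h.form_ee i j, sympForm_eq_zero_comm.mp ((he j).1 i), (he i).1 j, h'.form_ee i j]
  · rintro (i | i) (j | j)
    exacts [h.form_ff i j, sympForm_eq_zero_comm.mp ((hf j).2 i), (hf i).2 j, h'.form_ff i j]
  · rintro (i | i) (j | j)
    · simpa using h.form_ef i j
    · simpa using sympForm_eq_zero_comm.mp ((hf j).1 i)
    · simpa using (he i).2 j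
    · simpa using h'.form_ef i j

end Glue


/-- For y in L, φ(y, m x) = φ(m y, x) = 0. -/
theorem nsmul_mem_lagrangian (hL : L = N ⊓ orth L) {m : ℕ} (hm : ∀ x ∈ L, m • x = 0)
    {x : SympMod d n} (hx : x ∈ N) : m • x ∈ L := by
  rw [hL]
  refine ⟨nsmul_mem hx m, fun y hy => ?_⟩
  change sympForm d n y (m • x) = 0
  rw [sympForm_nsmul_right, ← sympForm_nsmul_left, hm y hy, map_zero,
    LinearMap.zero_apply]

variable [NeZero d]

/-- A vector of full order in a nondegenerate submodule pairs to `1` with some vector. -/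
theorem exists_sympForm_eq_one (hN : N ⊓ orth N = ⊥) {e : SympMod d n} (he : e ∈ N)
    (ho : addOrderOf e = d) : ∃ f ∈ N, sympForm d n e f = 1 := by
  -- The values φ(e, y) form a cyclic group I. Its exponent, which is its order, kills e by
  -- nondegeneracy, so it is divisible by d and I is everything.
  let I : AddSubgroup (ZMod d) := (N.map (sympForm d n e)).toAddSubgroup
  have h1 : AddMonoid.exponent I • e = 0 := by
    have : AddMonoid.exponent I • e ∈ N ⊓ orth N := by
      refine ⟨nsmul_mem he _, mem_orth.mpr fun y hy => ?_⟩
      rw [sympForm_nsmul_left, ← nsmul_eq_mul]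
      exact congrArg Subtype.val
        (AddMonoid.exponent_nsmul_eq_zero (⟨sympForm d n e y, y, hy, rfl⟩ : I))
    rwa [hN] at this
  have h2 : d ∣ Nat.card I := by
    rw [← IsAddCyclic.exponent_eq_card]
    exact ho.symm.dvd.trans (addOrderOf_dvd_of_nsmul_eq_zero h1)
  have h3 : I = ⊤ := by
    refine AddSubgroup.eq_top_of_card_eq _ (Nat.dvd_antisymm (AddSubgroup.card_addSubgroup_dvd_card I) ?_)
    rwa [Nat.card_zmod]
  have h4 : (1 : ZMod d) ∈ I := h3 ▸ trivial
  exact h4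

/-- Let m be the exponent of L and a = d/m. Then m f ∈ L for every f in N, so it suffices to find e
in N of order d with a e ∈ L; nondegeneracy supplies a partner f. -/
theorem exists_split_pair (hN : N ⊓ orth N = ⊥) {r : ℕ} (hr : TorsionRank d N r) (h0 : r ≠ 0)
    (hL : L = N ⊓ orth L) : ∃ e ∈ N, ∃ f ∈ N, ∃ a, a ∣ d ∧ sympForm d n e f = 1 ∧
      a • e ∈ L ∧ (d / a) • f ∈ L := by
  have hLN : L ≤ N := hL.le.trans inf_le_left
  obtain ⟨a, ha⟩ : AddMonoid.exponent L ∣ d :=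
    AddMonoid.exponent_dvd_of_forall_nsmul_eq_zero fun x => modulus_nsmul x
  have hm : ∀ x ∈ L, AddMonoid.exponent L • x = 0 := fun x hx =>
    congrArg Subtype.val (AddMonoid.exponent_nsmul_eq_zero (⟨x, hx⟩ : L))
  have hd0 := NeZero.pos d
  have ha0 : 0 < a := by
    rcases Nat.eq_zero_or_pos a with rfl | h
    · omega
    · exact h
  have had : a ∣ d := ⟨_, by rw [mul_comm, ← ha]⟩
  have hda : d / a = AddMonoid.exponent L := Nat.div_eq_of_eq_mul_left ha0 ha
  -- A consists of the candidates for e; a finite abelian group has an element whose order is its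
  -- exponent, so the claim is that A has exponent d.
  let A : AddSubgroup (SympMod d n) :=
    N.toAddSubgroup ⊓ L.toAddSubgroup.comap (nsmulAddMonoidHom a)
  have hA : ∀ {x}, x ∈ N → a • x ∈ L → AddMonoid.exponent A • x = 0 := fun {x} h1 h2 =>
    congrArg Subtype.val (AddMonoid.exponent_nsmul_eq_zero (⟨x, h1, h2⟩ : A))
  -- A contains the a-torsion of N. Its a^r elements are therefore killed by g = gcd(a, exp A),
  -- which kills only g^r elements; as r ≠ 0, g = a.
  have hg : a ∣ AddMonoid.exponent A := by
    set g := Nat.gcd a (AddMonoid.exponent A) with hgdef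
    have h1 : Nat.card {x : N // a • x = 0} ≤ Nat.card {x : N // g • x = 0} := by
      refine Nat.card_le_card_of_injective (fun x => ⟨x.1, ?_⟩) fun x y h =>
        Subtype.ext (congrArg (fun z => z.1) h)
      rw [← addOrderOf_dvd_iff_nsmul_eq_zero]
      refine Nat.dvd_gcd (addOrderOf_dvd_of_nsmul_eq_zero x.2)
        (addOrderOf_dvd_of_nsmul_eq_zero (Subtype.ext (hA x.1.2 ?_)))
      have : a • x.1.1 = 0 := congrArg Subtype.val x.2
      rw [this]
      exact zero_mem L
    rw [hr a had, hr g ((Nat.gcd_dvd_left _ _).trans had), Nat.pow_le_pow_iff_left h0] at h1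
    rw [← Nat.le_antisymm (Nat.gcd_le_left _ ha0) h1]
    exact Nat.gcd_dvd_right _ _
  -- Write exp A = a q. Every x in L is killed by m, hence is a y with y ∈ A, so q x = 0. Thus m
  -- divides q and d = a m divides exp A.
  have hexp : AddMonoid.exponent A = d := by
    refine Nat.dvd_antisymm
      (AddMonoid.exponent_dvd_of_forall_nsmul_eq_zero fun x => Subtype.ext (modulus_nsmul x.1)) ?_
    obtain ⟨q, hq⟩ := hg
    rw [hq]
    nth_rw 1 [ha]
    rw [mul_comm]
    refine Nat.mul_dvd_mul_left a (AddMonoid.exponent_dvd_of_forall_nsmul_eq_zero fun x => ?_)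
    obtain ⟨y, hy⟩ := hr.exists_nsmul_eq (a := a) (m := AddMonoid.exponent L) (by rw [mul_comm, ← ha])
      (x := ⟨x.1, hLN x.2⟩) (Subtype.ext (hm x.1 x.2))
    have hy' : a • y.1 = x.1 := congrArg Subtype.val hy
    have := hA y.2 (hy' ▸ x.2)
    rw [hq, mul_comm, mul_smul, hy'] at this
    exact Subtype.ext this
  obtain ⟨e, he⟩ := AddMonoid.exists_addOrderOf_eq_exponent (G := A) .of_finite
  rw [hexp, ← AddSubgroup.addOrderOf_coe] at he
  obtain ⟨f, hf, hef⟩ := exists_sympForm_eq_one hN e.2.1 he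
  exact ⟨e, e.2.1, f, hf, a, had, hef, e.2.2, hda ▸ nsmul_mem_lagrangian hL hm hf⟩

/-- If `a * c = 0` in `ℤ/d` then `c` is a multiple of `d / a`. -/
theorem exists_eq_mul_of_mul_eq_zero {a : ℕ} (ha : a ∣ d) {c : ZMod d} (h : (a : ZMod d) * c = 0) :
    ∃ t : ZMod d, c = t * ((d / a : ℕ) : ZMod d) := by
  rw [← ZMod.natCast_zmod_val c, ← Nat.cast_mul, ZMod.natCast_eq_zero_iff] at h
  obtain ⟨b, hb⟩ := ha
  have hd0 := NeZero.pos d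
  have ha0 : 0 < a := by
    rcases Nat.eq_zero_or_pos a with rfl | h
    · omega
    · exact h
  have hda : d / a = b := Nat.div_eq_of_eq_mul_right ha0 hb
  nth_rw 1 [hb] at h
  obtain ⟨t, ht⟩ := Nat.dvd_of_mul_dvd_mul_left ha0 h
  refine ⟨t, ?_⟩
  rw [hda, ← ZMod.natCast_zmod_val c, ht, Nat.cast_mul, mul_comm]

/-- The components of a vector orthogonal to `a_i e_i` and `(d / a_i) f_i` are multiples of these. -/
theorem IsSymplecticFamily.sum_mem_shiftSpan {ι : Type*} [Fintype ι]
    {e f : ι → SympMod d n} {a : ι → ℕ} (ha : ∀ i, a i ∣ d)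
    {x : SympMod d n} (hx : x ∈ orth (shiftSpan e f a)) :
    ∑ i, sympForm d n x (f i) • e i + ∑ i, sympForm d n (e i) x • f i ∈ shiftSpan e f a := by
  have h1 : ∀ i, a i • e i ∈ shiftSpan e f a := (shiftSpan_le.mp le_rfl).1
  have h2 : ∀ i, (d / a i) • f i ∈ shiftSpan e f a := (shiftSpan_le.mp le_rfl).2
  refine add_mem (sum_mem fun i _ => ?_) (sum_mem fun i _ => ?_)
  · have h3 := mem_orth.mp hx _ (h2 i)
    rw [map_nsmul, nsmul_eq_mul] at h3
    obtain ⟨t, ht⟩ := exists_eq_mul_of_mul_eq_zero (Nat.div_dvd_of_dvd (ha i)) h3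
    rw [ht, Nat.div_div_self (ha i) (NeZero.ne d), mul_smul, Nat.cast_smul_eq_nsmul]
    exact Submodule.smul_mem _ _ (h1 i)
  · have h3 := sympForm_eq_zero_comm.mp (mem_orth.mp hx _ (h1 i))
    rw [map_nsmul, LinearMap.smul_apply, nsmul_eq_mul] at h3
    obtain ⟨t, ht⟩ := exists_eq_mul_of_mul_eq_zero (ha i) h3
    rw [ht, mul_smul, Nat.cast_smul_eq_nsmul]
    exact Submodule.smul_mem _ _ (h2 i)

/-- A Lagrangian in a nondegenerate submodule has a split form in a symplectic basis. -/
theorem exists_split_basis (hd : 1 < d) (r : ℕ) : ∀ (N L : Submodule (ZMod d) (SympMod d n)),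
    N ⊓ orth N = ⊥ → TorsionRank d N r → L = N ⊓ orth L →
    ∃ (j : ℕ) (e f : Fin j → SympMod d n) (a : Fin j → ℕ), r = 2 * j ∧ IsSymplecticFamily e f ∧
      famSpan e f = N ∧ (∀ i, a i ∣ d) ∧ L = shiftSpan e f a := by
  induction r using Nat.strong_induction_on with
  | _ r ih =>
  intro N L hN hr hL
  have hLN : L ≤ N := hL.le.trans inf_le_left
  rcases eq_or_ne r 0 with rfl | h0
  · have h1 : N = ⊥ := by
      have := hr.card_eq
      rw [pow_zero, Nat.card_eq_one_iff_unique] at this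
      exact (Submodule.subsingleton_iff_eq_bot).mp this.1
    subst h1
    refine ⟨0, Fin.elim0, Fin.elim0, Fin.elim0, rfl, ⟨fun i => i.elim0, fun i => i.elim0,
      fun i => i.elim0⟩, ?_, fun i => i.elim0, ?_⟩
    · rw [eq_bot_iff, famSpan_le]
      exact ⟨fun i => i.elim0, fun i => i.elim0⟩
    · rw [le_bot_iff.mp hLN, eq_comm, eq_bot_iff, shiftSpan_le]
      exact ⟨fun i => i.elim0, fun i => i.elim0⟩
  · obtain ⟨e, he, f, hf, a, had, hef, hae, haf⟩ := exists_split_pair hN hr h0 hL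
    have hfam : IsSymplecticFamily (fun _ : Unit => e) (fun _ => f) :=
      ⟨fun _ _ => sympForm_self e, fun _ _ => sympForm_self f, fun i j => by simp [hef]⟩
    have hW : famSpan (fun _ : Unit => e) (fun _ => f) ≤ N := famSpan_le.mpr ⟨fun _ => he, fun _ => hf⟩
    obtain ⟨hr2, hr'⟩ := hfam.torsionRank_inf_orth hd hW hr
    simp only [Fintype.card_unit, mul_one] at hr2 hr'
    set W := famSpan (fun _ : Unit => e) (fun _ => f) with hWdef
    have hS : shiftSpan (fun _ : Unit => e) (fun _ => f) (fun _ => a) ≤ L :=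
      shiftSpan_le.mpr ⟨fun _ => hae, fun _ => haf⟩
    -- L is compatible with the splitting N = W ⊕ (N ∩ W^⊥): being orthogonal to a e and (d/a) f, a
    -- vector of L has its W-component in their span.
    have hdec : ∀ x ∈ L, ∃ y ∈ shiftSpan (fun _ : Unit => e) (fun _ => f) (fun _ => a),
        ∃ z ∈ L ⊓ orth W, y + z = x := by
      intro x hx
      have hy := IsSymplecticFamily.sum_mem_shiftSpan (fun _ : Unit => had)
        (x := x) (orth_anti hS (hL.le hx).2)
      exact ⟨_, hy, _, ⟨sub_mem hx (hS hy), hfam.exists_sub_mem_orth x⟩, add_sub_cancel _ _⟩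
    -- The remaining part of L is again Lagrangian in N ∩ W^⊥, so the induction applies.
    have hL' : L ⊓ orth W = (N ⊓ orth W) ⊓ orth (L ⊓ orth W) := by
      refine le_antisymm (fun x hx => ⟨⟨hLN hx.1, hx.2⟩, orth_anti inf_le_left (hL.le hx.1).2⟩) ?_
      rintro x ⟨⟨h1, h2⟩, h3⟩
      refine ⟨hL.ge ⟨h1, mem_orth.mpr fun y hy => ?_⟩, h2⟩
      obtain ⟨u, hu, v, hv, rfl⟩ := hdec y hy
      rw [map_add, mem_orth.mp h2 u (shiftSpan_le_famSpan hu), mem_orth.mp h3 v hv, add_zero]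
    obtain ⟨j, e', f', a', hj, hfam', hspan, ha', hLs⟩ :=
      ih (r - 2) (by omega) _ _ (hfam.inf_orth_inf_orth hN hW) hr' hL'
    let g : Fin (j + 1) ≃ Unit ⊕ Fin j := Fintype.equivOfCardEq (by simp [add_comm])
    refine ⟨j + 1, Sum.elim (fun _ => e) e' ∘ g, Sum.elim (fun _ => f) f' ∘ g,
      Sum.elim (fun _ => a) a' ∘ g, by omega,
      (hfam.sumElim hfam' (hspan.le.trans inf_le_right)).comp g, ?_, fun i => ?_, ?_⟩
    · rw [famSpan_comp, famSpan_sumElim, hspan]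
      refine le_antisymm (sup_le hW inf_le_left) fun x hx => ?_
      exact Submodule.mem_sup.mpr (hfam.exists_add_of_mem hW hx)
    · exact Sum.rec (motive := fun x => Sum.elim (fun _ => a) a' x ∣ d) (fun _ => had) ha' (g i)
    · rw [shiftSpan_comp, shiftSpan_sumElim, ← hLs]
      exact le_antisymm (fun x hx => Submodule.mem_sup.mpr (hdec x hx)) (sup_le hS inf_le_left)

end SplitLagrangian
-- Symplectic complements of L in L^⊥
section Complement

variable {d n : ℕ} {L : Submodule (ZMod d) (SympMod d n)}

/-- `L^⊥` is the sum of `L` and the span of a symplectic family with `2 j` members. -/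
def HasSymplecticComplement (L : Submodule (ZMod d) (SympMod d n)) (j : ℕ) : Prop :=
  ∃ e f : Fin j → SympMod d n, IsSymplecticFamily e f ∧ famSpan e f ≤ orth L ∧
    orth L ≤ L ⊔ famSpan e f

theorem torsionRank_top [NeZero d] :
    TorsionRank d (⊤ : Submodule (ZMod d) (SympMod d n)) (2 * n) := by
  have h := (torsionRank_pi d (Fin n ⊕ Fin n)).congr
    ((LinearEquiv.sumArrowLequivProdArrow (Fin n) (Fin n) (ZMod d) (ZMod d)).trans
      Submodule.topEquiv.symm).toAddEquiv
  rwa [Fintype.card_sum, Fintype.card_fin, ← two_mul] at h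

/-- For d = 1 the module M is zero and counting cannot detect ranks, so every j is allowed; this
case is kept apart throughout. -/
theorem hasSymplecticComplement_of_dim_one (hd : d = 1)
    (L : Submodule (ZMod d) (SympMod d n)) (j : ℕ) : HasSymplecticComplement L j := by
  subst hd
  refine ⟨0, 0, ⟨fun _ _ => Subsingleton.elim _ _, fun _ _ => Subsingleton.elim _ _,
    fun _ _ => Subsingleton.elim _ _⟩, fun x _ => ?_, fun x _ => ?_⟩ <;>
  · rw [Subsingleton.elim x 0]
    exact zero_mem _

/-- If l + f is orthogonal to F, then so is f, and f lies in F ∩ F^⊥ = 0. Thus L is Lagrangian in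
F^⊥. -/
theorem inf_orth_eq_of_complement {L F : Submodule (ZMod d) (SympMod d n)} (hL : L ≤ orth L)
    (hF : F ⊓ orth F = ⊥) (h1 : F ≤ orth L) (h2 : orth L ≤ L ⊔ F) : L = orth F ⊓ orth L := by
  have hLF : L ≤ orth F := le_orth_orth.trans (orth_anti h1)
  refine le_antisymm (le_inf hLF hL) ?_
  rintro x ⟨hx1, hx2⟩
  obtain ⟨l, hl, f, hf, rfl⟩ := Submodule.mem_sup.mp (h2 hx2)
  have : f ∈ F ⊓ orth F := ⟨hf, by simpa using sub_mem hx1 (hLF hl)⟩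
  rw [hF, Submodule.mem_bot] at this
  rwa [this, add_zero]

/-- A split basis of F^⊥ for the Lagrangian L, followed by the given basis of F, is a symplectic
basis of M. -/
theorem HasSymplecticComplement.exists_basis [NeZero d] {j k : ℕ} (h : HasSymplecticComplement L j)
    (hL : L ≤ orth L) (hk : k ≤ n) (hkj : k + j = n) :
    ∃ (e f : Fin n → SympMod d n) (a : Fin k → ℕ), IsSymplecticBasis e f ∧ (∀ i, a i ∣ d) ∧
      L = shiftSpan (fun i => e (Fin.castLE hk i)) (fun i => f (Fin.castLE hk i)) a := by
  rcases eq_or_ne d 1 with rfl | hd1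
  · refine ⟨0, 0, 1, ⟨?_, Subsingleton.elim _ _, fun _ _ => Subsingleton.elim _ _,
      fun _ _ => Subsingleton.elim _ _, fun _ _ => Subsingleton.elim _ _⟩, fun _ => one_dvd _,
      Subsingleton.elim _ _⟩
    exact Fintype.linearIndependent_iff.mpr fun _ _ _ => Subsingleton.elim _ _
  have hd : 1 < d := by have := NeZero.ne d; omega
  obtain ⟨e, f, hfam, h1, h2⟩ := h
  have hN := hfam.inf_orth_inf_orth (N := ⊤) (by rw [orth_top, inf_bot_eq]) le_top
  have hr := (hfam.torsionRank_inf_orth hd le_top torsionRank_top).2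
  rw [top_inf_eq] at hN hr
  obtain ⟨k', e', f', a, hk', hfam', hspan, ha, hLa⟩ := exists_split_basis hd _ _ L hN hr
    (inf_orth_eq_of_complement hL hfam.famSpan_inf_orth h1 h2)
  obtain rfl : k' = k := by rw [Fintype.card_fin] at hk'; omega
  subst hkj
  have hglue := ((hfam'.sumElim hfam (by rw [hspan]; exact le_orth_orth)).comp finSumFinEquiv.symm)
  refine ⟨_, _, a, ⟨hglue.linearIndependent, ?_, hglue.form_ee, hglue.form_ff, hglue.form_ef⟩, ha, ?_⟩
  · change famSpan _ _ = ⊤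
    rw [famSpan_comp, famSpan_sumElim, hspan, eq_top_iff]
    intro x _
    obtain ⟨y, hy, z, hz, rfl⟩ := hfam.exists_add_of_mem le_top (Submodule.mem_top (x := x))
    exact add_mem (Submodule.mem_sup_right hy) (Submodule.mem_sup_left hz.2)
  · have : ∀ i : Fin k', finSumFinEquiv.symm (Fin.castLE hk i) = (Sum.inl i : Fin k' ⊕ Fin j) :=
      fun i => finSumFinEquiv_symm_apply_castAdd i
    simp only [Function.comp_apply, this, Sum.elim_inl]
    exact hLa

theorem torsionRank_of_free [NeZero d] (hd : 1 < d) (N : Submodule (ZMod d) (SympMod d n))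
    [Module.Free (ZMod d) N] : ∃ r, TorsionRank d N r := by
  have : Nontrivial (ZMod d) := ZMod.nontrivial_iff.mpr (by omega)
  have : Module.Finite (ZMod d) N := Module.Finite.of_finite
  exact ⟨_, (torsionRank_pi d _).congr
    (Module.Free.chooseBasis (ZMod d) N).equivFun.symm.toAddEquiv⟩

theorem IsLagrangianInFreeSymplectic.exists_complement [NeZero d]
    (h : IsLagrangianInFreeSymplectic L) : ∃ j ≤ n, HasSymplecticComplement L j := by
  rcases eq_or_ne d 1 with hd1 | hd1
  · exact ⟨0, Nat.zero_le _, hasSymplecticComplement_of_dim_one hd1 L 0⟩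
  have hd : 1 < d := by have := NeZero.ne d; omega
  obtain ⟨N, hfree, hN, hLN, hL⟩ := h
  obtain ⟨r, hr⟩ := torsionRank_of_free hd N
  obtain ⟨k, e, f, a, -, hfam, rfl, -⟩ := exists_split_basis hd _ _ L hN hr hL
  have hF := hfam.inf_orth_inf_orth (N := ⊤) (by rw [orth_top, inf_bot_eq]) le_top
  have hs := (hfam.torsionRank_inf_orth hd le_top torsionRank_top).2
  rw [top_inf_eq] at hF hs
  -- Any Lagrangian serves here: `exists_split_basis` is only used to obtain a symplectic basis of
  -- N^⊥.
  obtain ⟨L', hL'⟩ := exists_lagrangian (orth (famSpan e f))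
  obtain ⟨j, e', f', -, hj, hfam', hspan, -⟩ := exists_split_basis hd _ _ L' hF hs hL'
  refine ⟨j, by omega, e', f', hfam', ?_, fun x hx => ?_⟩
  · rw [hspan]
    exact orth_anti hLN
  -- Decompose x = y + z along N ⊕ N^⊥. As z ∈ N^⊥ ⊆ L^⊥, also y ∈ N ∩ L^⊥ = L.
  · obtain ⟨y, hy, z, hz, rfl⟩ := hfam.exists_add_of_mem le_top (Submodule.mem_top (x := x))
    refine add_mem (Submodule.mem_sup_left (hL.ge ⟨hy, ?_⟩)) (Submodule.mem_sup_right ?_)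
    · simpa using sub_mem hx (orth_anti hLN hz.2)
    · rw [hspan]
      exact hz.2

theorem mem_orth_shiftSpan {ι : Type*} {e f : ι → SympMod d n} {a : ι → ℕ} {x : SympMod d n} :
    x ∈ orth (shiftSpan e f a) ↔ (∀ i, sympForm d n x (a i • e i) = 0) ∧
      ∀ i, sympForm d n x ((d / a i) • f i) = 0 := by
  have : x ∈ orth (shiftSpan e f a) ↔ shiftSpan e f a ≤ LinearMap.ker (sympForm d n x) := mem_orth
  rw [this, shiftSpan_le]
  rfl

/-- The generators are orthogonal because a_i · (d/a_i) = 0 in ℤ/d; maximality is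
`sum_mem_shiftSpan`. -/
theorem isLagrangianInFreeSymplectic_shiftSpan [NeZero d] {ι : Type*} [Fintype ι] [DecidableEq ι]
    {e f : ι → SympMod d n} (h : IsSymplecticFamily e f) {a : ι → ℕ} (ha : ∀ i, a i ∣ d) :
    IsLagrangianInFreeSymplectic (shiftSpan e f a) := by
  have hmul : ∀ i, ((a i : ℕ) : ZMod d) * ((d / a i : ℕ) : ZMod d) = 0 := fun i => by
    rw [← Nat.cast_mul, Nat.mul_div_cancel' (ha i), ZMod.natCast_self]
  have hef : ∀ i k, sympForm d n (a i • e i) ((d / a k) • f k) = 0 := fun i k => by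
    rw [sympForm_nsmul_left, sympForm_nsmul_right, h.form_ef]
    split_ifs with hik
    · rw [hik, mul_one, hmul]
    · rw [mul_zero, mul_zero]
  refine ⟨famSpan e f, Module.Free.of_basis (Module.Basis.span h.linearIndependent),
    h.famSpan_inf_orth, shiftSpan_le_famSpan,
    le_antisymm (le_inf shiftSpan_le_famSpan (shiftSpan_le.mpr ⟨?_, ?_⟩)) fun x hx => ?_⟩
  · exact fun i => mem_orth_shiftSpan.mpr ⟨fun k => by
      rw [sympForm_nsmul_left, sympForm_nsmul_right, h.form_ee, mul_zero, mul_zero], hef i⟩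
  · exact fun i => mem_orth_shiftSpan.mpr ⟨fun k => sympForm_eq_zero_comm.mp (hef k i), fun k => by
      rw [sympForm_nsmul_left, sympForm_nsmul_right, h.form_ff, mul_zero, mul_zero]⟩
  · have h1 := IsSymplecticFamily.sum_mem_shiftSpan ha hx.2
    have h2 : x - (∑ i, sympForm d n x (f i) • e i + ∑ i, sympForm d n (e i) x • f i) ∈
        famSpan e f ⊓ orth (famSpan e f) :=
      ⟨sub_mem hx.1 (sum_mem_famSpan _ _ _ _), h.exists_sub_mem_orth x⟩
    rw [h.famSpan_inf_orth, Submodule.mem_bot, sub_eq_zero] at h2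
    rwa [h2]

theorem IsSymplecticBasis.family {e f : Fin n → SympMod d n} (h : IsSymplecticBasis e f) :
    IsSymplecticFamily e f := ⟨h.form_ee, h.form_ff, h.form_ef⟩

end Complement
-- Commutators, powers and lifts in the Pauli group
section PauliGroup

variable {d n : ℕ} [NeZero d] {ζ : ℂˣ}

theorem pauli_ext {g g' : Pauli d n ζ}
    (h : ∀ v i, (g : Qudits d n ≃ₗ[ℂ] Qudits d n) v i = (g' : Qudits d n ≃ₗ[ℂ] Qudits d n) v i) :
    g = g' :=
  Subtype.ext (LinearEquiv.ext fun v => PiLp.ext (h v))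

theorem coe_mul_apply (g g' : Pauli d n ζ) (v : Qudits d n) :
    ((g * g' : Pauli d n ζ) : Qudits d n ≃ₗ[ℂ] Qudits d n) v =
      (g : Qudits d n ≃ₗ[ℂ] Qudits d n) ((g' : Qudits d n ≃ₗ[ℂ] Qudits d n) v) := rfl

theorem pauliScalar_zpow_apply (k : ℤ) (v : Qudits d n) (i : Fin n → ZMod d) :
    ((pauliScalar d n ζ ^ k : Pauli d n ζ) : Qudits d n ≃ₗ[ℂ] Qudits d n) v i =
      ((ζ ^ k : ℂˣ) : ℂ) * v i := by
  have hz : opScalar d n ζ ^ k = (LinearEquiv.smulOfUnit (ζ ^ k) : Qudits d n ≃ₗ[ℂ] _) :=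
    (map_zpow (DistribMulAction.toModuleAut ℂ (Qudits d n) (S := ℂˣ)) ζ k).symm
  change (opScalar d n ζ ^ k) v i = _
  rw [hz]
  rfl

theorem pauliScalar_pow_apply (k : ℕ) (v : Qudits d n) (i : Fin n → ZMod d) :
    ((pauliScalar d n ζ ^ k : Pauli d n ζ) : Qudits d n ≃ₗ[ℂ] Qudits d n) v i =
      ((ζ ^ k : ℂˣ) : ℂ) * v i := by
  simpa using pauliScalar_zpow_apply (d := d) (n := n) (ζ := ζ) (k : ℤ) v i

theorem pauliScalar_zpow_eq_one_iff (k : ℤ) : pauliScalar d n ζ ^ k = 1 ↔ ζ ^ k = 1 := by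
  refine ⟨fun h => ?_, fun h => pauli_ext fun v i => ?_⟩
  · have h1 := pauliScalar_zpow_apply (d := d) (n := n) (ζ := ζ) k (EuclideanSpace.single 0 1) 0
    rw [h] at h1
    refine Units.ext ?_
    simpa using h1.symm
  · rw [pauliScalar_zpow_apply, h]
    simp

theorem pauliScalar_mul_comm (k : ℤ) (g : Pauli d n ζ) :
    Commute (pauliScalar d n ζ ^ k) g := by
  refine Commute.zpow_left (pauli_ext fun v i => ?_) k
  rw [coe_mul_apply, coe_mul_apply]
  have h1 : (pauliScalar d n ζ : Qudits d n ≃ₗ[ℂ] Qudits d n) v = (ζ : ℂ) • v := rfl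
  rw [h1, map_smul]
  rfl

variable (hζ : IsPrimitiveRoot ζ (dbar d))

/-- `τ(g)`, written additively. -/
noncomputable def symb (g : Pauli d n ζ) : SympMod d n := (tau hζ g).toAdd

theorem symb_eq_iff {g : Pauli d n ζ} {m : SympMod d n} :
    symb hζ g = m ↔ tau hζ g = Multiplicative.ofAdd m := Iff.rfl

theorem hasSymbol_symb (g : Pauli d n ζ) : HasSymbol hζ (g : Qudits d n ≃ₗ[ℂ] _) (symb hζ g) :=
  (tau_eq_iff hζ g _).mp rfl

theorem symb_mul (g g' : Pauli d n ζ) : symb hζ (g * g') = symb hζ g + symb hζ g' := by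
  simp [symb]

theorem symb_one : symb hζ (1 : Pauli d n ζ) = 0 := by simp [symb]

theorem symb_inv (g : Pauli d n ζ) : symb hζ g⁻¹ = -symb hζ g := by simp [symb]

theorem symb_pow (g : Pauli d n ζ) (k : ℕ) : symb hζ (g ^ k) = k • symb hζ g := by simp [symb]

theorem symb_eq_zero_iff {g : Pauli d n ζ} :
    symb hζ g = 0 ↔ ∃ k : ℤ, pauliScalar d n ζ ^ k = g := by
  rw [← Subgroup.mem_zpowers_iff, ← tau_ker hζ]
  exact Iff.rfl

theorem symb_scalar (k : ℤ) : symb hζ (pauliScalar d n ζ ^ k) = 0 :=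
  (symb_eq_zero_iff hζ).mpr ⟨k, rfl⟩

theorem symb_mem_tauImage {H : Subgroup (Pauli d n ζ)} {g : Pauli d n ζ} (hg : g ∈ H) :
    symb hζ g ∈ tauImage hζ H := ⟨g, hg, rfl⟩

theorem symb_surjective : Function.Surjective (symb hζ : Pauli d n ζ → SympMod d n) := by
  have h1 : tauImage hζ (⊤ : Subgroup (Pauli d n ζ)) = ⊤ := by
    rw [eq_top_iff]
    rintro ⟨a, b⟩ -
    have : (a, b) = ∑ r, (a r • ((Pi.single r 1, 0) : SympMod d n) +
        b r • ((0, Pi.single r 1) : SympMod d n)) := by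
      refine Prod.ext (funext fun i => ?_) (funext fun i => ?_) <;>
        simp [Prod.fst_sum, Prod.snd_sum, Finset.sum_apply, Pi.single_apply]
    rw [this]
    exact sum_mem fun r _ => add_mem
      (Submodule.smul_mem _ _ ⟨_, trivial, tau_pauliZ hζ r⟩)
      (Submodule.smul_mem _ _ ⟨_, trivial, tau_pauliX hζ r⟩)
  intro m
  have h2 : m ∈ tauImage hζ (⊤ : Subgroup (Pauli d n ζ)) := h1 ▸ trivial
  obtain ⟨g, -, hg⟩ := h2
  exact ⟨g, hg⟩

/-- Moving one operator past the other shifts the argument of its phase; the two shifts differ by φ.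
The exponent is doubled because ξ = ζ². -/
theorem mul_eq_scalar_mul (g g' : Pauli d n ζ) : g * g' =
    pauliScalar d n ζ ^ (2 * (sympForm d n (symb hζ g) (symb hζ g')).val) * (g' * g) := by
  obtain ⟨c, -, h⟩ := hasSymbol_symb hζ g
  obtain ⟨c', -, h'⟩ := hasSymbol_symb hζ g'
  refine pauli_ext fun v i => ?_
  rw [coe_mul_apply _ (g' * g), pauliScalar_pow_apply, coe_mul_apply, coe_mul_apply, h, h', h', h,
    pow_mul]
  change _ = ((phase hζ _ : ℂˣ) : ℂ) * _
  set m := symb hζ g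
  set m' := symb hζ g'
  rw [sub_right_comm i m'.2 m.2, ← mul_assoc, ← mul_assoc, ← mul_assoc, ← Units.val_mul,
    ← Units.val_mul, ← Units.val_mul]
  congr 2
  have : phase hζ (m.1 ⬝ᵥ i) * phase hζ (m'.1 ⬝ᵥ (i - m.2)) =
      phase hζ (sympForm d n m m') * phase hζ (m'.1 ⬝ᵥ i) * phase hζ (m.1 ⬝ᵥ (i - m'.2)) := by
    rw [← AddChar.map_add_eq_mul, ← AddChar.map_add_eq_mul, ← AddChar.map_add_eq_mul,
      sympForm_apply, dotProduct_sub, dotProduct_sub, dotProduct_comm m.2]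
    congr 1
    ring
  calc c * phase hζ (m.1 ⬝ᵥ i) * (c' * phase hζ (m'.1 ⬝ᵥ (i - m.2)))
      = c * c' * (phase hζ (m.1 ⬝ᵥ i) * phase hζ (m'.1 ⬝ᵥ (i - m.2))) := by ac_rfl
    _ = _ := by rw [this]; ac_rfl

include hζ in
theorem scalar_val_eq_one_iff (t : ZMod d) : pauliScalar d n ζ ^ (2 * t.val) = 1 ↔ t = 0 := by
  rw [← zpow_natCast, pauliScalar_zpow_eq_one_iff, zpow_natCast, pow_mul]
  change phase hζ t = 1 ↔ _
  rw [← AddChar.map_zero_eq_one (phase hζ), (phase_injective hζ).eq_iff]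

theorem mul_comm_iff (g g' : Pauli d n ζ) :
    g * g' = g' * g ↔ sympForm d n (symb hζ g) (symb hζ g') = 0 := by
  rw [← scalar_val_eq_one_iff (n := n) hζ, mul_eq_scalar_mul hζ g g', mul_eq_right]

/-- The successive shifts contribute phases 0 + 1 + ⋯ + (k - 1), hence the binomial coefficient. -/
theorem pow_apply {g : Qudits d n ≃ₗ[ℂ] Qudits d n} {m : SympMod d n} {c : ℂˣ}
    (h : ∀ (v : Qudits d n) (i : Fin n → ZMod d),
      g v i = ((c * phase hζ (m.1 ⬝ᵥ i) : ℂˣ) : ℂ) * v (i - m.2)) (k : ℕ) (v : Qudits d n)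
    (i : Fin n → ZMod d) : (g ^ k) v i =
      ((c ^ k * phase hζ (k * (m.1 ⬝ᵥ i) - k.choose 2 * (m.1 ⬝ᵥ m.2)) : ℂˣ) : ℂ) *
        v (i - k • m.2) := by
  induction k generalizing i with
  | zero => simp
  | succ k ih =>
    rw [pow_succ', LinearEquiv.mul_apply, h, ih, ← mul_assoc, ← Units.val_mul, succ_nsmul',
      sub_sub]
    congr 2
    have : phase hζ (m.1 ⬝ᵥ i) * phase hζ (k * (m.1 ⬝ᵥ (i - m.2)) - k.choose 2 * (m.1 ⬝ᵥ m.2)) =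
        phase hζ ((k + 1 : ℕ) * (m.1 ⬝ᵥ i) - (k + 1).choose 2 * (m.1 ⬝ᵥ m.2)) := by
      rw [← AddChar.map_add_eq_mul, dotProduct_sub, Nat.choose_succ_succ' k 1, Nat.choose_one_right]
      congr 1
      push_cast
      ring
    rw [← this, pow_succ']
    ac_rfl

/-- This is where d̄ is needed: for even d, d does not divide `d.choose 2`. -/
theorem dvd_choose_dbar (d : ℕ) : d ∣ (dbar d).choose 2 := by
  rw [Nat.choose_two_right]
  unfold dbar
  split_ifs with h
  · rw [mul_assoc, Nat.mul_div_cancel_left _ two_pos]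
    exact dvd_mul_right _ _
  · obtain ⟨k, hk⟩ := Nat.not_even_iff_odd.mp h
    have : d - 1 = 2 * k := by omega
    rw [this, ← mul_assoc, mul_comm d 2, mul_assoc, Nat.mul_div_cancel_left _ two_pos]
    exact dvd_mul_right _ _

theorem exists_dbar_eq (d : ℕ) : ∃ ε, ε ≠ 0 ∧ dbar d = ε * d := by
  unfold dbar
  split_ifs
  exacts [⟨2, by decide, rfl⟩, ⟨1, by decide, (one_mul d).symm⟩]

include hζ in
theorem pow_dbar (g : Pauli d n ζ) : g ^ dbar d = 1 := by
  obtain ⟨c, hc, h⟩ := hasSymbol_symb hζ g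
  have hd : ((dbar d : ℕ) : ZMod d) = 0 := by
    obtain ⟨ε, -, hε⟩ := exists_dbar_eq d
    rw [hε, Nat.cast_mul, ZMod.natCast_self, mul_zero]
  have hc' : c ^ dbar d = 1 := by
    obtain ⟨k, rfl⟩ := Subgroup.mem_zpowers_iff.mp hc
    rw [← zpow_natCast, zpow_comm, zpow_natCast, hζ.pow_eq_one, one_zpow]
  refine pauli_ext fun v i => ?_
  change ((g : Qudits d n ≃ₗ[ℂ] Qudits d n) ^ dbar d) v i = v i
  rw [pow_apply hζ h, hc', hd, (ZMod.natCast_eq_zero_iff _ _).mpr (dvd_choose_dbar d),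
    ← Nat.cast_smul_eq_nsmul (ZMod d), hd]
  simp

/-- If `a ∣ d` and `a • e ∈ τ(H)`, then `e` has a lift of order dividing `d`
whose `a`-th power lies in `H`. -/
theorem exists_lift {H : Subgroup (Pauli d n ζ)} (hH : IsStabilizer H) {e : SympMod d n} {a : ℕ}
    (ha : a ∣ d) (he : a • e ∈ tauImage hζ H) :
    ∃ g : Pauli d n ζ, symb hζ g = e ∧ g ^ d = 1 ∧ g ^ a ∈ H := by
  obtain ⟨ε, hε0, hε⟩ := exists_dbar_eq d
  have hd0 : d ≠ 0 := NeZero.ne d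
  obtain ⟨g, hg⟩ : ∃ g : Pauli d n ζ, symb hζ g = e ∧ g ^ d = 1 := by
    obtain ⟨g, hg⟩ := symb_surjective hζ e
    obtain ⟨t, ht⟩ := (symb_eq_zero_iff hζ (g := g ^ d)).mp (by rw [symb_pow, modulus_nsmul])
    -- With d̄ = ε d, the scalar g^d = ζ^t has ε-th power 1. So d divides t, and g can be corrected
    -- by a d-th root of that scalar.
    have h1 : pauliScalar d n ζ ^ (t * ε) = 1 := by
      rw [zpow_mul, ht, zpow_natCast, ← pow_mul, mul_comm d, ← hε, pow_dbar hζ]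
    rw [pauliScalar_zpow_eq_one_iff, hζ.zpow_eq_one_iff_dvd, hε, Nat.cast_mul, mul_comm t] at h1
    obtain ⟨s, rfl⟩ := Int.dvd_of_mul_dvd_mul_left (by exact_mod_cast hε0) h1
    refine ⟨pauliScalar d n ζ ^ (-s) * g, by rw [symb_mul, symb_scalar, zero_add, hg], ?_⟩
    rw [Commute.mul_pow (pauliScalar_mul_comm _ _), ← ht, ← zpow_natCast, ← zpow_mul, ← zpow_add]
    simp [mul_comm]
  obtain ⟨h, hh, hhe⟩ := he
  replace hhe : symb hζ h = a • e := hhe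
  obtain ⟨t, ht⟩ := (symb_eq_zero_iff hζ (g := h * (g ^ a)⁻¹)).mp
    (by rw [symb_mul, symb_inv, symb_pow, hg.1, hhe, add_neg_cancel])
  have hh' : h = pauliScalar d n ζ ^ t * g ^ a := by rw [ht, inv_mul_cancel_right]
  obtain ⟨m, hm⟩ := ha
  have ha0 : a ≠ 0 := by rintro rfl; simp [hd0] at hm
  have hm0 : m ≠ 0 := by rintro rfl; simp [hd0] at hm
  -- With d = a m, the power h^m is a scalar in H, hence trivial. This forces ε a ∣ t.
  have h1 : h ^ m = 1 := by
    have h2 : h ^ m ∈ H ⊓ Subgroup.zpowers (pauliScalar d n ζ) := by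
      refine ⟨pow_mem hh m, Subgroup.mem_zpowers_iff.mpr ((symb_eq_zero_iff hζ).mp ?_)⟩
      rw [symb_pow, hhe, smul_smul, mul_comm m, ← hm, modulus_nsmul]
    rwa [hH.no_scalar, Subgroup.mem_bot] at h2
  have h2 : pauliScalar d n ζ ^ (t * m) = 1 := by
    rw [hh', Commute.mul_pow (pauliScalar_mul_comm _ _), ← pow_mul, ← hm, hg.2, mul_one,
      ← zpow_natCast, ← zpow_mul] at h1
    exact h1
  rw [pauliScalar_zpow_eq_one_iff, hζ.zpow_eq_one_iff_dvd, hε, hm] at h2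
  obtain ⟨s, rfl⟩ : ((ε * a : ℕ) : ℤ) ∣ t := by
    refine Int.dvd_of_mul_dvd_mul_left (a := (m : ℤ)) (by exact_mod_cast hm0) ?_
    convert h2 using 1
    · push_cast; ring
    · ring
  -- The factor ζ^(εs) has d-th power 1, so the order condition survives, and its a-th power turns
  -- g^a into h.
  refine ⟨pauliScalar d n ζ ^ (ε * s) * g, by rw [symb_mul, symb_scalar, zero_add, hg.1], ?_, ?_⟩
  · rw [Commute.mul_pow (pauliScalar_mul_comm _ _), hg.2, mul_one, ← zpow_natCast, ← zpow_mul,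
      pauliScalar_zpow_eq_one_iff, hζ.zpow_eq_one_iff_dvd, hε]
    exact ⟨s, by push_cast; ring⟩
  · rw [Commute.mul_pow (pauliScalar_mul_comm _ _), ← zpow_natCast, ← zpow_mul]
    convert hh using 1
    rw [hh']
    congr 2
    push_cast
    ring

end PauliGroup

/-! ### Stabiliser groups and their normalisers -/

section Stabilizer

variable {d n : ℕ} [NeZero d] {ζ : ℂˣ} (hζ : IsPrimitiveRoot ζ (dbar d))
  {H : Subgroup (Pauli d n ζ)} (hH : IsStabilizer H)

include hH in
theorem IsStabilizer.tauImage_le_orth : tauImage hζ H ≤ orth (tauImage hζ H) := by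
  rintro _ ⟨g, hg, rfl⟩
  refine mem_orth.mpr ?_
  rintro _ ⟨g', hg', rfl⟩
  exact (mul_comm_iff hζ g g').mp (hH.comm g hg g' hg')

include hH in
theorem IsStabilizer.eq_one_of_symb {g : Pauli d n ζ} (hg : g ∈ H) (h : symb hζ g = 0) : g = 1 := by
  have : g ∈ H ⊓ Subgroup.zpowers (pauliScalar d n ζ) :=
    ⟨hg, Subgroup.mem_zpowers_iff.mpr ((symb_eq_zero_iff hζ).mp h)⟩
  rwa [hH.no_scalar, Subgroup.mem_bot] at this

include hH in
theorem IsStabilizer.eq_of_symb {g g' : Pauli d n ζ} (hg : g ∈ H) (hg' : g' ∈ H)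
    (h : symb hζ g = symb hζ g') : g = g' := by
  rw [← mul_inv_eq_one]
  refine hH.eq_one_of_symb hζ (mul_mem hg (inv_mem hg')) ?_
  rw [symb_mul, symb_inv, h, add_neg_cancel]

include hH in
theorem IsStabilizer.eq_of_le {K : Subgroup (Pauli d n ζ)} (hK : K ≤ H)
    (h : tauImage hζ H ≤ tauImage hζ K) : K = H := by
  refine le_antisymm hK fun g hg => ?_
  obtain ⟨g', hg', hs⟩ := h (symb_mem_tauImage hζ hg)
  rwa [hH.eq_of_symb hζ hg (hK hg') (symb_eq_iff hζ |>.mpr hs).symm]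

/-- `τ` restricts to an isomorphism of a stabiliser group with its image. -/
noncomputable def IsStabilizer.equivTauImage : H ≃* Multiplicative (tauImage hζ H) :=
  MulEquiv.ofBijective
    (MonoidHom.mk' (fun g => Multiplicative.ofAdd ⟨symb hζ g.1, symb_mem_tauImage hζ g.2⟩)
      fun g g' => congrArg Multiplicative.ofAdd (Subtype.ext (symb_mul hζ g.1 g'.1)))
    ⟨fun g g' h => Subtype.ext (hH.eq_of_symb hζ g.2 g'.2
        (congrArg Subtype.val (Multiplicative.ofAdd.injective h))),
      fun m => by
        obtain ⟨m, g, hg, hm⟩ := m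
        exact ⟨⟨g, hg⟩, congrArg Multiplicative.ofAdd (Subtype.ext hm)⟩⟩

-- Conjugation preserves symbols and τ is injective on H, so normalising H means centralising it.
include hH in
theorem IsStabilizer.mem_normalizer_iff {g : Pauli d n ζ} :
    g ∈ Subgroup.normalizer (H : Set (Pauli d n ζ)) ↔ symb hζ g ∈ orth (tauImage hζ H) := by
  rw [mem_orth]
  constructor
  · rintro hg _ ⟨h, hh, rfl⟩
    refine (mul_comm_iff hζ g h).mp ?_
    have h1 : g * h * g⁻¹ ∈ H := (Subgroup.mem_set_normalizer_iff.mp hg h).mp hh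
    have h2 := hH.eq_of_symb hζ h1 hh (by rw [symb_mul, symb_mul, symb_inv]; abel)
    rwa [mul_inv_eq_iff_eq_mul] at h2
  · intro hg
    have key : ∀ {g : Pauli d n ζ}, (∀ h ∈ H, g * h = h * g) → ∀ h ∈ H, g * h * g⁻¹ ∈ H :=
      fun hg h hh => by rwa [hg h hh, mul_inv_cancel_right]
    have hc : ∀ h ∈ H, g * h = h * g := fun h hh =>
      (mul_comm_iff hζ g h).mpr (hg _ (symb_mem_tauImage hζ hh))
    refine Subgroup.mem_set_normalizer_iff.mpr fun h => ⟨key hc h, fun hh => ?_⟩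
    have h1 := key (g := g⁻¹) (fun h hh => by
      rw [inv_mul_eq_iff_eq_mul, ← mul_assoc, hc h hh, mul_inv_cancel_right]) _ hh
    have h2 : g⁻¹ * (g * h * g⁻¹) * g⁻¹⁻¹ = h := by group
    exact h2 ▸ h1

/-- A homomorphism with commuting values whose composition with `τ` is injective has a stabiliser
group as its range. -/
theorem isStabilizer_range {G : Type*} [Group G] (σ : G →* Pauli d n ζ)
    (hc : ∀ x y, σ x * σ y = σ y * σ x) (hσ : ∀ x, symb hζ (σ x) = 0 → x = 1) :
    IsStabilizer σ.range := by
  refine ⟨?_, ?_⟩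
  · rintro _ ⟨x, rfl⟩ _ ⟨y, rfl⟩
    exact hc x y
  · rw [Subgroup.eq_bot_iff_forall]
    rintro _ ⟨⟨x, rfl⟩, hx⟩
    rw [hσ x ((symb_eq_zero_iff hζ).mpr (Subgroup.mem_zpowers_iff.mp hx)), map_one]

end Stabilizer
-- Homomorphisms from (ℤ/d)^ι given by commuting elements
section Powers

variable {d : ℕ} [NeZero d] {G : Type*} [Group G]

/-- The homomorphism `t ↦ g ^ t` from `ℤ/d`, for `g` with `g ^ d = 1`. -/
def zmodPow (g : G) (hg : g ^ d = 1) : Multiplicative (ZMod d) →* G :=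
  MonoidHom.mk' (fun t => g ^ t.toAdd.val) fun s t => by
    rw [toAdd_mul, ZMod.val_add, ← pow_eq_pow_mod _ hg, pow_add]

theorem zmodPow_apply (g : G) (hg : g ^ d = 1) (t : Multiplicative (ZMod d)) :
    zmodPow g hg t = g ^ t.toAdd.val := rfl

theorem zmodPow_one (g : G) (hg : g ^ d = 1) : zmodPow g hg (Multiplicative.ofAdd 1) = g := by
  rw [zmodPow_apply, toAdd_ofAdd, ZMod.val_one_eq_one_mod, ← pow_eq_pow_mod _ hg, pow_one]

variable {ι : Type*} {Z : ι → G} (hc : ∀ i j, Z i * Z j = Z j * Z i)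
  (hp : ∀ i, Z i ^ d = 1)

include hc in
theorem pairwise_commute_zmodPow : Pairwise fun i j => ∀ x y : Multiplicative (ZMod d),
    Commute (zmodPow (Z i) (hp i) x) (zmodPow (Z j) (hp j) y) :=
  fun i j _ _ _ => Commute.pow_pow (hc i j) _ _

variable [Fintype ι]

/-- The homomorphism `t ↦ ∏ Z_i ^ {t_i}` from `(ℤ/d)^ι`. -/
noncomputable def zmodPiPow : (ι → Multiplicative (ZMod d)) →* G :=
  MonoidHom.noncommPiCoprod (fun i => zmodPow (Z i) (hp i)) (pairwise_commute_zmodPow hc hp)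

theorem zmodPiPow_mulSingle [DecidableEq ι] (i : ι) (t : Multiplicative (ZMod d)) :
    zmodPiPow hc hp (Pi.mulSingle i t) = Z i ^ t.toAdd.val :=
  MonoidHom.noncommPiCoprod_mulSingle _ _ _

theorem range_zmodPiPow : (zmodPiPow hc hp).range = Subgroup.closure (Set.range Z) := by
  classical
  refine le_antisymm ?_ ?_
  · rw [zmodPiPow, MonoidHom.noncommPiCoprod_range, iSup_le_iff]
    rintro i _ ⟨t, rfl⟩
    exact pow_mem (Subgroup.subset_closure (Set.mem_range_self i)) _
  · rw [Subgroup.closure_le]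
    rintro _ ⟨i, rfl⟩
    refine ⟨Pi.mulSingle i (Multiplicative.ofAdd 1), ?_⟩
    rw [zmodPiPow_mulSingle]
    exact zmodPow_one (Z i) (hp i)

theorem map_zmodPiPow {A : Type*} [CommGroup A] (f : G →* A) (t : ι → Multiplicative (ZMod d)) :
    f (zmodPiPow hc hp t) = ∏ i, f (Z i) ^ (t i).toAdd.val := by
  simp only [zmodPiPow, MonoidHom.noncommPiCoprod, MonoidHom.coe_mk, OneHom.coe_mk,
    Finset.map_noncommProd, Finset.noncommProd_eq_prod, zmodPow_apply, map_pow]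

end Powers

/-! ### Shifted free subgroups -/

section Shift

variable {d n : ℕ} [NeZero d] {ζ : ℂˣ} (hζ : IsPrimitiveRoot ζ (dbar d))
  {H : Subgroup (Pauli d n ζ)}

theorem symb_zmodPiPow {ι : Type*} [Fintype ι] {Z : ι → Pauli d n ζ}
    (hc : ∀ i j, Z i * Z j = Z j * Z i) (hp : ∀ i, Z i ^ d = 1) (t : ι → Multiplicative (ZMod d)) :
    symb hζ (zmodPiPow hc hp t) = ∑ i, (t i).toAdd • symb hζ (Z i) := by
  rw [symb, map_zmodPiPow, toAdd_prod]
  refine Finset.sum_congr rfl fun i _ => ?_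
  rw [toAdd_pow, ← Nat.cast_smul_eq_nsmul (ZMod d), ZMod.natCast_zmod_val]
  rfl

theorem isStabilizer_closure_range {ι : Type*} [Fintype ι] {Z : ι → Pauli d n ζ}
    (hc : ∀ i j, Z i * Z j = Z j * Z i) (hp : ∀ i, Z i ^ d = 1)
    (hli : LinearIndependent (ZMod d) fun i => symb hζ (Z i)) :
    IsStabilizer (Subgroup.closure (Set.range Z)) := by
  rw [← range_zmodPiPow hc hp]
  refine isStabilizer_range hζ _ (fun x y => by rw [← map_mul, mul_comm, map_mul]) fun t ht => ?_
  rw [symb_zmodPiPow] at ht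
  exact funext fun i => Fintype.linearIndependent_iff.mp hli (fun i => (t i).toAdd) ht i

theorem tauImage_closure (S : Set (Pauli d n ζ)) :
    tauImage hζ (Subgroup.closure S) = Submodule.span (ZMod d) (symb hζ '' S) := by
  refine le_antisymm ?_ (Submodule.span_le.mpr ?_)
  · rintro _ ⟨g, hg, rfl⟩
    change symb hζ g ∈ _
    induction hg using Subgroup.closure_induction with
    | mem x hx => exact Submodule.subset_span ⟨x, hx, rfl⟩
    | one => rw [symb_one]; exact zero_mem _
    | mul x y _ _ hx hy => rw [symb_mul]; exact add_mem hx hy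
    | inv x _ hx => rw [symb_inv]; exact neg_mem hx
  · rintro _ ⟨g, hg, rfl⟩
    exact symb_mem_tauImage hζ (Subgroup.subset_closure hg)

theorem tauImage_shift {ι : Type*} {e f : ι → SympMod d n} {Z X : ι → Pauli d n ζ} {a : ι → ℕ}
    (hZ : ∀ i, symb hζ (Z i) = e i) (hX : ∀ i, symb hζ (X i) = f i) :
    tauImage hζ (Subgroup.closure ((Set.range fun i => Z i ^ a i) ∪
      Set.range fun i => X i ^ (d / a i))) = shiftSpan e f a := by
  rw [tauImage_closure, Set.image_union, ← Set.range_comp, ← Set.range_comp]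
  simp only [Function.comp_def, symb_pow, hZ, hX]

/-- Lifts of order dividing `d` of a symplectic family satisfy the Pauli relations. -/
theorem pauliRelations_of_family {e f : Fin n → SympMod d n} (h : IsSymplecticFamily e f)
    {Z X : Fin n → Pauli d n ζ} (hZ : ∀ i, symb hζ (Z i) = e i) (hX : ∀ i, symb hζ (X i) = f i)
    (hZd : ∀ i, Z i ^ d = 1) (hXd : ∀ i, X i ^ d = 1) : PauliRelations Z X := by
  refine ⟨fun k r => ?_, fun k r => ?_, fun k r hkr => ?_, fun k => ?_, hXd, hZd⟩
  · rw [mul_comm_iff hζ, hX, hX, h.form_ff]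
  · rw [mul_comm_iff hζ, hZ, hZ, h.form_ee]
  · rw [mul_comm_iff hζ, hX, hZ, h.form_fe, if_neg hkr.symm]
  · rw [mul_eq_scalar_mul hζ, hZ, hX, h.form_ef, if_pos rfl, ZMod.val_one_eq_one_mod]
    congr 1
    -- For d = 1 the representative of 1 in ℤ/d is 0, so exponents of ξ are compared modulo d.
    have h1 : (pauliScalar d n ζ ^ 2) ^ d = 1 := by
      rw [← pow_mul, ← zpow_natCast, pauliScalar_zpow_eq_one_iff, zpow_natCast, pow_mul]
      exact (isPrimitiveRoot_sq hζ).pow_eq_one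
    rw [pow_mul, ← pow_eq_pow_mod _ h1, pow_one]

/-- The lifts are chosen so that the required powers lie in H. They generate a subgroup of H with
the same image under τ, hence H itself. -/
theorem isShiftedFree_of_basis (hH : IsStabilizer H) {k : ℕ} (hk : k ≤ n)
    {e f : Fin n → SympMod d n} {a : Fin k → ℕ} (hb : IsSymplecticBasis e f)
    (ha : ∀ i, a i ∣ d) (hL : tauImage hζ H =
      shiftSpan (fun i => e (Fin.castLE hk i)) (fun i => f (Fin.castLE hk i)) a) :
    IsShiftedFree hζ H := by
  have hlift : ∀ (g : Fin n → SympMod d n) (b : Fin k → ℕ), (∀ i, b i ∣ d) →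
      (∀ i, b i • g (Fin.castLE hk i) ∈ tauImage hζ H) →
      ∃ Y : Fin n → Pauli d n ζ, (∀ r, symb hζ (Y r) = g r) ∧ (∀ r, Y r ^ d = 1) ∧
        ∀ i, Y (Fin.castLE hk i) ^ b i ∈ H := by
    intro g b hb hbg
    have h : ∀ r, ∃ y : Pauli d n ζ, symb hζ y = g r ∧ y ^ d = 1 ∧
        ∀ i, Fin.castLE hk i = r → y ^ b i ∈ H := by
      intro r
      by_cases hr : ∃ i, Fin.castLE hk i = r
      · obtain ⟨i, rfl⟩ := hr
        obtain ⟨y, h1, h2, h3⟩ := exists_lift hζ hH (hb i) (hbg i)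
        exact ⟨y, h1, h2, fun i' hi' => by rwa [Fin.castLE_injective hk hi']⟩
      -- Beyond the first k indices only the order matters; taking a = d makes the condition on H
      -- vacuous.
      · obtain ⟨y, h1, h2, -⟩ := exists_lift hζ hH (e := g r) dvd_rfl
          (by rw [modulus_nsmul]; exact zero_mem _)
        exact ⟨y, h1, h2, fun i hi => absurd ⟨i, hi⟩ hr⟩
    choose Y h1 h2 h3 using h
    exact ⟨Y, h1, h2, fun i => h3 _ i rfl⟩
  obtain ⟨hae, haf⟩ := shiftSpan_le.mp hL.ge
  obtain ⟨Z, hZ, hZd, hZH⟩ := hlift e a ha hae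
  obtain ⟨X, hX, hXd, hXH⟩ := hlift f (fun i => d / a i) (fun i => Nat.div_dvd_of_dvd (ha i)) haf
  have hR := pauliRelations_of_family hζ hb.family hZ hX hZd hXd
  have hli : LinearIndependent (ZMod d) fun i => e (Fin.castLE hk i) :=
    hb.linearIndependent.comp (fun i => Sum.inl (Fin.castLE hk i)) fun i j hij =>
      Fin.castLE_injective hk (Sum.inl.inj hij)
  have hH' : IsStabilizer (Subgroup.closure (Set.range fun i => Z (Fin.castLE hk i))) :=
    isStabilizer_closure_range hζ (fun i j => hR.comm_ZZ _ _) (fun i => hZd _)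
      (by simpa only [hZ] using hli)
  have hspan : tauImage hζ (Subgroup.closure (Set.range fun i => Z (Fin.castLE hk i))) =
      Submodule.span (ZMod d) (Set.range fun i => e (Fin.castLE hk i)) := by
    rw [tauImage_closure, ← Set.range_comp]
    simp only [Function.comp_def, hZ]
  refine ⟨k, hk, _, hH', ⟨(hH'.equivTauImage hζ).trans ?_⟩, e, f, Z, X, a, hb, hspan.symm, hZ, hX,
    hR, rfl, ha, (hH.eq_of_le hζ ((Subgroup.closure_le _).mpr ?_) ?_).symm⟩
  · rw [hspan]
    exact AddEquiv.toMultiplicative (Module.Basis.span hli).equivFun.toAddEquiv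
  · rintro _ (⟨i, rfl⟩ | ⟨i, rfl⟩)
    exacts [hZH i, hXH i]
  · rw [tauImage_shift hζ (fun i => hZ (Fin.castLE hk i)) fun i => hX (Fin.castLE hk i), hL]

theorem IsShiftedFree.isLagrangian (h : IsShiftedFree hζ H) :
    IsLagrangianInFreeSymplectic (tauImage hζ H) := by
  obtain ⟨k, hk, H', -, -, e, f, Z, X, a, hb, -, hZ, hX, -, -, ha, rfl⟩ := h
  rw [tauImage_shift hζ (fun i => hZ (Fin.castLE hk i)) fun i => hX (Fin.castLE hk i)]
  have hfam : IsSymplecticFamily (fun i => e (Fin.castLE hk i)) fun i => f (Fin.castLE hk i) :=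
    ⟨fun _ _ => hb.form_ee _ _, fun _ _ => hb.form_ff _ _, fun i j => by
      simp [hb.form_ef, (Fin.castLE_injective hk).eq_iff]⟩
  exact isLagrangianInFreeSymplectic_shiftSpan hfam ha

end Shift
-- Unitarity, traces and the dimension of V^H
section FixedSpace

variable {d n : ℕ} [NeZero d] {ζ : ℂˣ} (hζ : IsPrimitiveRoot ζ (dbar d))
  {H : Subgroup (Pauli d n ζ)}

include hζ in
theorem norm_of_mem_zpowers {c : ℂˣ} (hc : c ∈ Subgroup.zpowers ζ) : ‖(c : ℂ)‖ = 1 := by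
  have h0 : dbar d ≠ 0 := by
    obtain ⟨ε, hε, h⟩ := exists_dbar_eq d
    rw [h]
    exact mul_ne_zero hε (NeZero.ne d)
  have hc' : c ^ dbar d = 1 := by
    obtain ⟨k, rfl⟩ := Subgroup.mem_zpowers_iff.mp hc
    rw [← zpow_natCast, zpow_comm, zpow_natCast, hζ.pow_eq_one, one_zpow]
  refine Complex.norm_eq_one_of_pow_eq_one (n := dbar d) ?_ h0
  rw [← Units.val_pow_eq_pow_val, hc', Units.val_one]

include hζ in
/-- Pauli operators are unitary. -/
theorem inner_pauli (g : Pauli d n ζ) (v w : Qudits d n) :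
    inner ℂ ((g : Qudits d n ≃ₗ[ℂ] Qudits d n) v) ((g : Qudits d n ≃ₗ[ℂ] Qudits d n) w) =
      inner ℂ v w := by
  obtain ⟨c, hc, h⟩ := hasSymbol_symb hζ g
  rw [PiLp.inner_apply, PiLp.inner_apply,
    ← (Equiv.subRight (symb hζ g).2).sum_comp fun i => inner ℂ (v i) (w i)]
  refine Finset.sum_congr rfl fun i _ => ?_
  rw [h, h]
  set u : ℂˣ := c * phase hζ ((symb hζ g).1 ⬝ᵥ i)
  have hu : ‖(u : ℂ)‖ = 1 := norm_of_mem_zpowers hζ (mul_mem hc (phase_mem hζ _))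
  have h1 : (starRingEnd ℂ) (u : ℂ) * u = 1 := by
    rw [Complex.conj_mul', hu]
    simp
  simp only [RCLike.inner_apply, map_mul, Equiv.subRight_apply]
  linear_combination ((starRingEnd ℂ) (v (i - (symb hζ g).2)) * w (i - (symb hζ g).2)) * h1

theorem trace_pauli (g : Pauli d n ζ) : LinearMap.trace ℂ (Qudits d n)
    (g : Qudits d n ≃ₗ[ℂ] Qudits d n).toLinearMap =
      ∑ i, (g : Qudits d n ≃ₗ[ℂ] Qudits d n) (EuclideanSpace.single i 1) i := by
  rw [LinearMap.trace_eq_matrix_trace ℂ (EuclideanSpace.basisFun _ ℂ).toBasis, Matrix.trace]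
  refine Finset.sum_congr rfl fun i _ => ?_
  simp [LinearMap.toMatrix_apply]

-- A nonzero x-part leaves no diagonal entries; otherwise the trace is a multiple of the sum of a
-- nontrivial character.
include hζ in
theorem trace_pauli_eq_zero {g : Pauli d n ζ} (hg : symb hζ g ≠ 0) :
    LinearMap.trace ℂ (Qudits d n) (g : Qudits d n ≃ₗ[ℂ] Qudits d n).toLinearMap = 0 := by
  obtain ⟨c, hc, h⟩ := hasSymbol_symb hζ g
  rw [trace_pauli]
  simp_rw [h]
  by_cases h2 : (symb hζ g).2 = 0
  · have h1 : (symb hζ g).1 ≠ 0 := fun h1 => hg (Prod.ext h1 h2)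
    let ψ : AddChar (Fin n → ZMod d) ℂ :=
      ((Units.coeHom ℂ).compAddChar (phase hζ)).compAddMonoidHom
        (AddMonoidHom.mk' (fun i => (symb hζ g).1 ⬝ᵥ i) fun i k => dotProduct_add _ _ _)
    have hψ : ψ ≠ 0 := by
      intro h0
      refine h1 (funext fun r => ?_)
      have := DFunLike.congr_fun h0 (Pi.single r 1)
      refine phase_injective hζ (Units.ext ?_)
      simpa [ψ] using this
    have hsum : ∑ i, ψ i = 0 := AddChar.sum_eq_zero_iff_ne_zero.mpr hψ
    calc _ = ∑ i, (c : ℂ) * ψ i := by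
          refine Finset.sum_congr rfl fun i _ => ?_
          simp [h2, ψ]
      _ = 0 := by rw [← Finset.mul_sum, hsum, mul_zero]
  · refine Finset.sum_eq_zero fun i _ => ?_
    simp [h2]

/-- The action of a subgroup of the Pauli group on `V`. -/
def subgroupRep (H : Subgroup (Pauli d n ζ)) : Representation ℂ H (Qudits d n) where
  toFun g := (g.1 : Qudits d n ≃ₗ[ℂ] Qudits d n).toLinearMap
  map_one' := rfl
  map_mul' _ _ := rfl

theorem invariants_subgroupRep (H : Subgroup (Pauli d n ζ)) :
    (subgroupRep H).invariants = fixedSpace H :=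
  Submodule.ext fun _ => ⟨fun h g hg => h ⟨g, hg⟩, fun h g => h g.1 g.2⟩

-- The dimension is the trace of the averaging projection, to which only the identity of H
-- contributes.
include hζ in
theorem card_mul_finrank_fixedSpace (hH : IsStabilizer H) :
    Nat.card H * Module.finrank ℂ (fixedSpace H) = d ^ n := by
  classical
  have : Finite H := Finite.of_equiv _ (hH.equivTauImage hζ).symm.toEquiv
  have := Fintype.ofFinite H
  have h0 : (Fintype.card H : ℂ) ≠ 0 := Nat.cast_ne_zero.mpr Fintype.card_ne_zero
  let _ : Invertible (Fintype.card H : ℂ) := invertibleOfNonzero h0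
  have h1 := (Representation.isProj_averageMap (subgroupRep H)).trace
  rw [invariants_subgroupRep] at h1
  have h2 : (subgroupRep H).averageMap =
      ⅟(Fintype.card H : ℂ) • ∑ g : H, subgroupRep H g := by
    simp [Representation.averageMap, GroupAlgebra.average, map_sum]
  have h3 : ∀ g : H, LinearMap.trace ℂ (Qudits d n) (subgroupRep H g) =
      if g = 1 then (d : ℂ) ^ n else 0 := by
    intro g
    split_ifs with hg
    · rw [hg, map_one, LinearMap.trace_one]
      simp
    · exact trace_pauli_eq_zero hζ fun h => hg (Subtype.ext (hH.eq_one_of_symb hζ g.2 h))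
  rw [h2, map_smul, map_sum, Finset.sum_congr rfl fun g _ => h3 g, Finset.sum_ite_eq'] at h1
  simp only [Finset.mem_univ, if_true, smul_eq_mul] at h1
  rw [Nat.card_eq_fintype_card]
  have h4 : (Fintype.card H : ℂ) * (Module.finrank ℂ (fixedSpace H) : ℂ) = (d : ℂ) ^ n := by
    rw [← h1, mul_invOf_cancel_left]
  exact_mod_cast h4

include hζ in
theorem exists_unit_mem_fixedSpace (hH : IsStabilizer H) : ∃ v ∈ fixedSpace H, ‖v‖ = 1 := by
  have h := card_mul_finrank_fixedSpace hζ hH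
  have h1 : 0 < Module.finrank ℂ (fixedSpace H) := by
    refine Nat.pos_of_ne_zero fun h0 => ?_
    rw [h0, mul_zero] at h
    exact pow_ne_zero n (NeZero.ne d) h.symm
  have := Module.nontrivial_of_finrank_pos h1
  obtain ⟨v, hv⟩ := exists_norm_eq (fixedSpace H) zero_le_one
  exact ⟨v, v.2, hv⟩

/-- As L is Lagrangian in F^⊥, |F^⊥| = |L|², so d^(2n) = d^(2j) |L|²; now divide d^n by |H| = |L|.
-/
theorem finrank_fixedSpace {j : ℕ} (hH : IsStabilizer H)
    (hC : HasSymplecticComplement (tauImage hζ H) j) :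
    Module.finrank ℂ (fixedSpace H) = d ^ j := by
  obtain ⟨e, f, hfam, h1, h2⟩ := hC
  have hL := inf_orth_eq_of_complement (hH.tauImage_le_orth hζ) hfam.famSpan_inf_orth h1 h2
  have hN := hfam.inf_orth_inf_orth (N := ⊤) (by rw [orth_top, inf_bot_eq]) le_top
  rw [top_inf_eq] at hN
  have c1 := card_eq_card_mul_card_orth hN (hL.le.trans inf_le_left)
  rw [← hL] at c1
  have c2 := card_mul_card_orth (famSpan e f)
  rw [c1, hfam.torsionRank_famSpan.card_eq, Fintype.card_fin] at c2
  have c3 : Nat.card H = Nat.card (tauImage hζ H) := Nat.card_congr (hH.equivTauImage hζ).toEquiv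
  have c4 := card_mul_finrank_fixedSpace hζ hH
  rw [c3] at c4
  set l := Nat.card (tauImage hζ H) with hl
  have hl0 : 0 < l := Nat.card_pos
  have c5 : (d ^ j * l) ^ 2 = (d ^ n) ^ 2 := by
    rw [← pow_mul, mul_comm n, ← c2]
    ring
  rw [Nat.pow_left_inj two_ne_zero, ← c4, mul_comm] at c5
  exact (Nat.eq_of_mul_eq_mul_left hl0 c5).symm

end FixedSpace
-- The standard basis of V^H
section StoneVonNeumann

variable {d n : ℕ} [NeZero d] {ζ : ℂˣ} (hζ : IsPrimitiveRoot ζ (dbar d))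
  {H : Subgroup (Pauli d n ζ)}

theorem apply_apply_eq_phase_smul (g g' : Pauli d n ζ) (v : Qudits d n) :
    (g : Qudits d n ≃ₗ[ℂ] Qudits d n) ((g' : Qudits d n ≃ₗ[ℂ] Qudits d n) v) =
      ((phase hζ (sympForm d n (symb hζ g) (symb hζ g')) : ℂˣ) : ℂ) •
        (g' : Qudits d n ≃ₗ[ℂ] Qudits d n) ((g : Qudits d n ≃ₗ[ℂ] Qudits d n) v) := by
  rw [← coe_mul_apply, mul_eq_scalar_mul hζ, coe_mul_apply]
  refine PiLp.ext fun i => ?_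
  rw [pauliScalar_pow_apply, pow_mul]
  rfl

theorem exists_family_lift {ι : Type*} (hH : IsStabilizer H) (e : ι → SympMod d n) :
    ∃ Z : ι → Pauli d n ζ, (∀ i, symb hζ (Z i) = e i) ∧ ∀ i, Z i ^ d = 1 := by
  have h : ∀ i, ∃ g : Pauli d n ζ, symb hζ g = e i ∧ g ^ d = 1 := fun i => by
    obtain ⟨g, h1, h2, -⟩ := exists_lift hζ hH (e := e i) dvd_rfl
      (by rw [modulus_nsmul]; exact zero_mem _)
    exact ⟨g, h1, h2⟩
  choose Z h1 h2 using h
  exact ⟨Z, h1, h2⟩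

/-- Adjoining lifts of the first half of a symplectic family in `L^⊥` to a stabiliser group. -/
theorem exists_unit_fixed {ι : Type*} [Fintype ι] [DecidableEq ι] (hH : IsStabilizer H)
    {e f : ι → SympMod d n} (hfam : IsSymplecticFamily e f)
    (hF : famSpan e f ≤ orth (tauImage hζ H)) {Z : ι → Pauli d n ζ}
    (hZ : ∀ i, symb hζ (Z i) = e i) (hZd : ∀ i, Z i ^ d = 1) :
    ∃ v ∈ fixedSpace H, ‖v‖ = 1 ∧ ∀ i, (Z i : Qudits d n ≃ₗ[ℂ] Qudits d n) v = v := by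
  have hZc : ∀ i k, Z i * Z k = Z k * Z i := fun i k => by
    rw [mul_comm_iff hζ, hZ, hZ, hfam.form_ee]
  have he : ∀ i, e i ∈ orth (tauImage hζ H) := (famSpan_le.mp hF).1
  have hHZ : ∀ h ∈ H, ∀ i, Commute h (Z i) := fun h hh i => (mul_comm_iff hζ h (Z i)).mpr (by
    rw [hZ, sympForm_eq_zero_comm]
    exact mem_orth.mp (he i) _ (symb_mem_tauImage hζ hh))
  have hcomm : ∀ (h : H) (t : ι → Multiplicative (ZMod d)),
      Commute (H.subtype h) (zmodPiPow hZc hZd t) := fun h t => by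
    refine (mul_comm_iff hζ _ _).mpr ?_
    rw [symb_zmodPiPow, map_sum]
    refine Finset.sum_eq_zero fun i _ => ?_
    rw [map_smul, Subgroup.subtype_apply, (mul_comm_iff hζ _ _).mp (hHZ h.1 h.2 i), smul_zero]
  let σ : H × (ι → Multiplicative (ZMod d)) →* Pauli d n ζ :=
    MonoidHom.noncommCoprod H.subtype (zmodPiPow hZc hZd) hcomm
  have hσ : ∀ p, σ p = p.1.1 * zmodPiPow hZc hZd p.2 := fun p => rfl
  have hA : IsStabilizer σ.range := by
    refine isStabilizer_range hζ σ (fun p q => ?_) fun p hp => ?_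
    · have h1 : p.1 * q.1 = q.1 * p.1 := Subtype.ext (hH.comm _ p.1.2 _ q.1.2)
      have h2 : p * q = q * p := Prod.ext h1 (mul_comm p.2 q.2)
      rw [← map_mul, h2, map_mul]
    · rw [hσ, symb_mul, symb_zmodPiPow] at hp
      -- Pairing with f_i kills the symbol from H and reads off the i-th exponent.
      have hp0 : ∀ i, (p.2 i).toAdd = 0 := by
        intro i
        have h1 := congrArg (fun x => sympForm d n x (f i)) hp
        have h2 : sympForm d n (symb hζ p.1.1) (f i) = 0 := sympForm_eq_zero_comm.mp
          (mem_orth.mp ((famSpan_le.mp hF).2 i) _ (symb_mem_tauImage hζ p.1.2))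
        simpa [hZ, hfam.form_ef, h2] using h1
      have hp1 : symb hζ p.1.1 = 0 := by simpa [hp0] using hp
      exact Prod.ext (Subtype.ext (hH.eq_one_of_symb hζ p.1.2 hp1)) (funext hp0)
  obtain ⟨v, hv, hv1⟩ := exists_unit_mem_fixedSpace hζ hA
  refine ⟨v, fun h hh => hv h ⟨(⟨h, hh⟩, 1), by rw [hσ, map_one, mul_one]⟩, hv1, fun i => ?_⟩
  have hi : Z i ∈ (zmodPiPow hZc hZd).range := by
    rw [range_zmodPiPow]
    exact Subgroup.subset_closure (Set.mem_range_self i)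
  obtain ⟨t, ht⟩ := hi
  exact hv (Z i) ⟨(1, t), by rw [hσ, ht]; exact one_mul _⟩

/-- `V^H` has an orthonormal basis on which lifts of a symplectic basis of a complement of `τ(H)` in
its orthogonal act as the standard generators of a Pauli group. -/
theorem exists_orthonormalBasis {j : ℕ} (hH : IsStabilizer H) {e f : Fin j → SympMod d n}
    (hfam : IsSymplecticFamily e f) (hF : famSpan e f ≤ orth (tauImage hζ H))
    (hF' : orth (tauImage hζ H) ≤ tauImage hζ H ⊔ famSpan e f) :
    ∃ (Z X : Fin j → Pauli d n ζ) (b : OrthonormalBasis (Fin j → ZMod d) ℂ (fixedSpace H)),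
      (∀ r, symb hζ (Z r) = e r) ∧ (∀ r, symb hζ (X r) = f r) ∧
      (∀ r i, (Z r : Qudits d n ≃ₗ[ℂ] Qudits d n) (b i) =
        ((phase hζ (i r) : ℂˣ) : ℂ) • (b i : Qudits d n)) ∧
      ∀ r i, (X r : Qudits d n ≃ₗ[ℂ] Qudits d n) (b i) = b (i + Pi.single r 1) := by
  obtain ⟨Z, hZ, hZd⟩ := exists_family_lift hζ hH e
  obtain ⟨X, hX, hXd⟩ := exists_family_lift hζ hH f
  obtain ⟨v, hvH, hv1, hvZ⟩ := exists_unit_fixed hζ hH hfam hF hZ hZd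
  have hXc : ∀ i k, X i * X k = X k * X i := fun i k => by
    rw [mul_comm_iff hζ, hX, hX, hfam.form_ff]
  let σ : (Fin j → ZMod d) → Pauli d n ζ := fun i =>
    zmodPiPow hXc hXd fun r => Multiplicative.ofAdd (i r)
  have hσ : ∀ i, symb hζ (σ i) = ∑ r, i r • f r := fun i => by
    rw [symb_zmodPiPow]
    simp [hX]
  -- The basis vectors are w_i = ∏ X_r^{i_r} v, with v fixed by H and by all Z_r.
  let w : (Fin j → ZMod d) → Qudits d n := fun i => (σ i : Qudits d n ≃ₗ[ℂ] Qudits d n) v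
  have hwX : ∀ r i, (X r : Qudits d n ≃ₗ[ℂ] Qudits d n) (w i) = w (i + Pi.single r 1) := by
    intro r i
    have h1 : X r = zmodPiPow hXc hXd (Pi.mulSingle r (Multiplicative.ofAdd 1)) := by
      rw [zmodPiPow_mulSingle]
      exact (zmodPow_one (X r) (hXd r)).symm
    have h2 : X r * σ i = σ (i + Pi.single r 1) := by
      rw [h1, ← map_mul, mul_comm]
      congr 1
    change _ = (σ (i + Pi.single r 1) : Qudits d n ≃ₗ[ℂ] Qudits d n) v
    rw [← h2, coe_mul_apply]
  have hwZ : ∀ r i, (Z r : Qudits d n ≃ₗ[ℂ] Qudits d n) (w i) =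
      ((phase hζ (i r) : ℂˣ) : ℂ) • w i := by
    intro r i
    have h1 : sympForm d n (e r) (∑ s, i s • f s) = i r := by simp [hfam.form_ef]
    change (Z r : Qudits d n ≃ₗ[ℂ] Qudits d n) ((σ i : Qudits d n ≃ₗ[ℂ] Qudits d n) v) = _
    rw [apply_apply_eq_phase_smul hζ, hZ, hσ, h1, hvZ]
  have hwH : ∀ i, w i ∈ fixedSpace H := by
    intro i h hh
    have h1 : sympForm d n (symb hζ h) (∑ s, i s • f s) = 0 := by
      rw [sympForm_eq_zero_comm]
      refine mem_orth.mp (sum_mem fun s _ => Submodule.smul_mem _ _ ?_) _ (symb_mem_tauImage hζ hh)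
      exact (famSpan_le.mp hF).2 s
    change (h : Qudits d n ≃ₗ[ℂ] Qudits d n) ((σ i : Qudits d n ≃ₗ[ℂ] Qudits d n) v) = _
    rw [apply_apply_eq_phase_smul hζ, hσ, h1, hvH h hh, AddChar.map_zero_eq_one, Units.val_one,
      one_smul]
  have hon : Orthonormal ℂ fun i => (⟨w i, hwH i⟩ : fixedSpace H) := by
    refine ⟨fun i => ?_, fun i k hik => ?_⟩
    · change ‖w i‖ = 1
      rw [← sq_eq_sq₀ (norm_nonneg _) zero_le_one, ← hv1]
      have h1 := inner_pauli hζ (σ i) v v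
      rw [inner_self_eq_norm_sq_to_K, inner_self_eq_norm_sq_to_K] at h1
      exact_mod_cast h1
    · change inner ℂ (w i) (w k) = 0
      -- Distinct indices differ in some coordinate r, so w_i and w_k are eigenvectors of the
      -- unitary Z_r for distinct eigenvalues.
      obtain ⟨r, hr⟩ := Function.ne_iff.mp hik
      have h1 := inner_pauli hζ (Z r) (w i) (w k)
      rw [hwZ, hwZ, inner_smul_left, inner_smul_right, ← mul_assoc] at h1
      by_contra h0
      have h2 := mul_right_cancel₀ h0 (h1.trans (one_mul _).symm)
      have h3 : (starRingEnd ℂ) ((phase hζ (i r) : ℂˣ) : ℂ) * ((phase hζ (i r) : ℂˣ) : ℂ) = 1 := by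
        rw [Complex.conj_mul', norm_of_mem_zpowers hζ (phase_mem hζ _)]
        simp
      have h4 : (starRingEnd ℂ) ((phase hζ (i r) : ℂˣ) : ℂ) ≠ 0 := left_ne_zero_of_mul_eq_one h3
      exact hr (phase_injective hζ (Units.ext (mul_left_cancel₀ h4 (h3.trans h2.symm))))
  have hcard : Fintype.card (Fin j → ZMod d) = Module.finrank ℂ (fixedSpace H) := by
    rw [finrank_fixedSpace hζ hH ⟨e, f, hfam, hF, hF'⟩, ← Nat.card_eq_fintype_card, Nat.card_fun,
      Nat.card_zmod, Nat.card_fin]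
  let B := basisOfOrthonormalOfCardEqFinrank hon hcard
  have hB : ⇑B = fun i => (⟨w i, hwH i⟩ : fixedSpace H) :=
    coe_basisOfOrthonormalOfCardEqFinrank hon hcard
  let b := B.toOrthonormalBasis (hB ▸ hon)
  have hb : ∀ i, (b i : Qudits d n) = w i := fun i => by
    rw [Module.Basis.coe_toOrthonormalBasis, hB]
  refine ⟨Z, X, b, hZ, hX, fun r i => ?_, fun r i => ?_⟩
  · rw [hb, hwZ]
  · rw [hb, hb, hwX]

end StoneVonNeumann
-- The isomorphism of N(H)/H with a Pauli group
section Equivariance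

variable {d n j : ℕ} [NeZero d] {ζ : ℂˣ} (hζ : IsPrimitiveRoot ζ (dbar d))
  {H : Subgroup (Pauli d n ζ)}

/-- The action of `N(H)/H` on `V^H`, transported along `V^H ≃ W`. -/
def transportRep {W : Type*} [AddCommGroup W] [Module ℂ W] (H : Subgroup (Pauli d n ζ))
    (U : fixedSpace H ≃ₗ[ℂ] W) : NormQuot H →* (W ≃ₗ[ℂ] W) :=
  MonoidHom.mk'
    (fun g => U.symm.trans ((LinearMap.GeneralLinearGroup.generalLinearEquiv ℂ (fixedSpace H)
      ((quotRep H).asGroupHom g)).trans U))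
    fun g g' => LinearEquiv.ext fun v => by simp [LinearEquiv.mul_apply]

theorem transportRep_apply {W : Type*} [AddCommGroup W] [Module ℂ W] (U : fixedSpace H ≃ₗ[ℂ] W)
    (g : NormQuot H) (v : fixedSpace H) : transportRep H U g (U v) = U (quotRep H g v) := by
  simp only [transportRep, MonoidHom.mk'_apply, LinearEquiv.trans_apply, LinearEquiv.symm_apply_apply]
  rfl

theorem transportRep_eq {W : Type*} [AddCommGroup W] [Module ℂ W] (U : fixedSpace H ≃ₗ[ℂ] W)
    {ι : Type*} (b : Module.Basis ι ℂ (fixedSpace H)) (A : W ≃ₗ[ℂ] W) (g : NormQuot H)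
    (h : ∀ i, U (quotRep H g (b i)) = A (U (b i))) : transportRep H U g = A := by
  refine LinearEquiv.toLinearMap_injective ((b.map U).ext fun i => ?_)
  simp only [Module.Basis.map_apply, LinearEquiv.coe_coe]
  rw [transportRep_apply, h]

include hζ in
/-- An element of `N(H)` that acts trivially on `V^H` belongs to `H`. -/
theorem mem_of_quotRep_eq_one (hH : IsStabilizer H)
    (g : Subgroup.normalizer (H : Set (Pauli d n ζ)))
    (hg : ∀ v : fixedSpace H, quotRep H (QuotientGroup.mk g) v = v) : (g : Pauli d n ζ) ∈ H := by
  obtain ⟨v, hv, hv1⟩ := exists_unit_mem_fixedSpace hζ hH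
  have hg' : ∀ v ∈ fixedSpace H, ((g : Pauli d n ζ) : Qudits d n ≃ₗ[ℂ] Qudits d n) v = v :=
    fun v hv => congrArg Subtype.val (hg ⟨v, hv⟩)
  have hv0 : ∀ y : Pauli d n ζ, (y : Qudits d n ≃ₗ[ℂ] Qudits d n) v ≠ 0 := fun y hy => by
    rw [LinearEquiv.map_eq_zero_iff] at hy
    rw [hy, norm_zero] at hv1
    exact zero_ne_one hv1
  -- Every y in N(H) preserves V^H, where g acts trivially, so g and y commute on a nonzero vector
  -- and φ(τ(g), τ(y)) = 0. Hence τ(g) ∈ L^⊥⊥ = L.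
  have h1 : symb hζ (g : Pauli d n ζ) ∈ tauImage hζ H := by
    rw [← orth_orth (N := tauImage hζ H), mem_orth]
    intro m hm
    obtain ⟨y, rfl⟩ := symb_surjective hζ m
    have h2 := apply_apply_eq_phase_smul hζ g y v
    rw [hg' _ (normalizer_apply_mem H ((hH.mem_normalizer_iff hζ).mpr hm) hv), hg' v hv] at h2
    have h3 := smul_left_injective ℂ (hv0 y) ((one_smul ℂ _).trans h2)
    refine phase_injective hζ (Units.ext ?_)
    rw [AddChar.map_zero_eq_one]
    exact h3.symm
  obtain ⟨h, hh, hs⟩ := h1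
  obtain ⟨t, ht⟩ := (symb_eq_zero_iff hζ (g := (g : Pauli d n ζ) * h⁻¹)).mp (by
    rw [symb_mul, symb_inv, (symb_eq_iff hζ).mpr hs, add_neg_cancel])
  have h4 : (g : Pauli d n ζ) = pauliScalar d n ζ ^ t * h := by rw [ht, inv_mul_cancel_right]
  have h5 : pauliScalar d n ζ ^ t = 1 := by
    rw [pauliScalar_zpow_eq_one_iff]
    have h6 := hg' v hv
    rw [h4, coe_mul_apply, hv h hh] at h6
    obtain ⟨i, hi⟩ : ∃ i, v i ≠ 0 := by
      by_contra! hall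
      exact hv0 1 (PiLp.ext hall)
    have h7 := congrArg (fun w : Qudits d n => w i) h6
    simp only [pauliScalar_zpow_apply] at h7
    refine Units.ext (mul_right_cancel₀ hi (h7.trans ?_))
    rw [Units.val_one, one_mul]
  rw [h4, h5, one_mul]
  exact hh

/-- A subgroup of `P_n` that contains the scalars and whose image contains `τ(g)` contains `g`. -/
theorem mem_of_symb_mem {S : Subgroup (Pauli d n ζ)} (hS : pauliScalar d n ζ ∈ S)
    {g : Pauli d n ζ} (hg : symb hζ g ∈ tauImage hζ S) : g ∈ S := by
  obtain ⟨s, hs, hsg⟩ := hg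
  obtain ⟨t, ht⟩ := (symb_eq_zero_iff hζ (g := g * s⁻¹)).mp (by
    rw [symb_mul, symb_inv, (symb_eq_iff hζ).mpr hsg, add_neg_cancel])
  have : g = pauliScalar d n ζ ^ t * s := by rw [ht, inv_mul_cancel_right]
  rw [this]
  exact mul_mem (zpow_mem hS t) hs

/-- In the coordinates of the standard basis, N(H)/H acts faithfully, and its image is exactly P_j;
Ψ is this action, so it is equivariant by construction. -/
theorem exists_equivariant_equiv (hH : IsStabilizer H)
    (hC : HasSymplecticComplement (tauImage hζ H) j) :
    ∃ (Ψ : NormQuot H ≃* Pauli d j ζ) (U : fixedSpace H ≃ₗᵢ[ℂ] Qudits d j),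
      ∀ (g : NormQuot H) (v : fixedSpace H),
        U (quotRep H g v) = (Ψ g : Qudits d j ≃ₗ[ℂ] Qudits d j) (U v) := by
  obtain ⟨e, f, hfam, hF, hF'⟩ := hC
  obtain ⟨Z, X, b, hZ, hX, hbZ, hbX⟩ := exists_orthonormalBasis hζ hH hfam hF hF'
  let U : fixedSpace H ≃ₗᵢ[ℂ] Qudits d j := b.repr
  have hU : ∀ i, U (b i) = EuclideanSpace.single i 1 := fun i => b.repr_self i
  let ρ := transportRep H U.toLinearEquiv
  have hρ : ∀ (A : Qudits d j ≃ₗ[ℂ] Qudits d j) (g : Subgroup.normalizer (H : Set (Pauli d n ζ))),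
      (∀ i, U ⟨((g : Pauli d n ζ) : Qudits d n ≃ₗ[ℂ] Qudits d n) (b i),
        normalizer_apply_mem H g.2 (b i).2⟩ = A (EuclideanSpace.single i 1)) →
      ρ (QuotientGroup.mk g) = A := fun A g h =>
    transportRep_eq U.toLinearEquiv b.toBasis A _ fun i => by
      rw [OrthonormalBasis.coe_toBasis]
      refine (h i).trans ?_
      rw [← hU]
      rfl
  have hZN : ∀ r, Z r ∈ Subgroup.normalizer (H : Set (Pauli d n ζ)) := fun r =>
    (hH.mem_normalizer_iff hζ).mpr (by rw [hZ]; exact (famSpan_le.mp hF).1 r)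
  have hXN : ∀ r, X r ∈ Subgroup.normalizer (H : Set (Pauli d n ζ)) := fun r =>
    (hH.mem_normalizer_iff hζ).mpr (by rw [hX]; exact (famSpan_le.mp hF).2 r)
  have hSN : pauliScalar d n ζ ∈ Subgroup.normalizer (H : Set (Pauli d n ζ)) :=
    (hH.mem_normalizer_iff hζ).mpr (by
      rw [← zpow_one (pauliScalar d n ζ), symb_scalar]; exact zero_mem _)
  have hρZ : ∀ r, ρ (QuotientGroup.mk ⟨Z r, hZN r⟩) = opZ d j ζ r := fun r => hρ _ _ fun i => by
    have h1 : (⟨(Z r : Qudits d n ≃ₗ[ℂ] Qudits d n) (b i),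
        normalizer_apply_mem H (hZN r) (b i).2⟩ : fixedSpace H) =
        ((phase hζ (i r) : ℂˣ) : ℂ) • b i := Subtype.ext (hbZ r i)
    rw [h1, map_smul, hU]
    refine PiLp.ext fun k => ?_
    rw [opZ_apply, PiLp.smul_apply, smul_eq_mul]
    rcases eq_or_ne k i with rfl | hk
    · rfl
    · simp [hk]
  have hρX : ∀ r, ρ (QuotientGroup.mk ⟨X r, hXN r⟩) = opX d j r := fun r => hρ _ _ fun i => by
    have h1 : (⟨(X r : Qudits d n ≃ₗ[ℂ] Qudits d n) (b i),
        normalizer_apply_mem H (hXN r) (b i).2⟩ : fixedSpace H) =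
        b (i + Pi.single r 1) := Subtype.ext (hbX r i)
    rw [h1, hU]
    refine PiLp.ext fun k => ?_
    rw [opX_apply]
    simp [sub_eq_iff_eq_add]
  have hρS : ρ (QuotientGroup.mk ⟨pauliScalar d n ζ, hSN⟩) = opScalar d j ζ := hρ _ _ fun i => by
    have h1 : (⟨(pauliScalar d n ζ : Qudits d n ≃ₗ[ℂ] Qudits d n) (b i),
        normalizer_apply_mem H hSN (b i).2⟩ : fixedSpace H) = (ζ : ℂ) • b i := rfl
    rw [h1, map_smul, hU]
    rfl
  have hinj : Function.Injective ρ := by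
    refine (injective_iff_map_eq_one ρ).mpr fun q hq => ?_
    induction q using QuotientGroup.induction_on with
    | H g =>
      refine (QuotientGroup.eq_one_iff g).mpr (Subgroup.mem_subgroupOf.mpr
        (mem_of_quotRep_eq_one hζ hH g fun v => U.injective ?_))
      have h1 := transportRep_apply U.toLinearEquiv (QuotientGroup.mk g) v
      exact (h1.symm.trans (congrArg (fun A : Qudits d j ≃ₗ[ℂ] Qudits d j => A (U v)) hq))
  have hrange : ρ.range = Pauli d j ζ := by
    refine le_antisymm ?_ ((Subgroup.closure_le _).mpr ?_)
    -- S consists of the elements of N(H) acting by operators of P_j. It contains the scalars, H and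
    -- the lifts of F, so its image contains L + F ⊇ L^⊥ and S is all of N(H).
    · let S : Subgroup (Pauli d n ζ) := (((Pauli d j ζ).comap ρ).comap
        (QuotientGroup.mk' _)).map (Subgroup.subtype _)
      have hS : ∀ g : Subgroup.normalizer (H : Set (Pauli d n ζ)),
          ρ (QuotientGroup.mk g) ∈ Pauli d j ζ → (g : Pauli d n ζ) ∈ S := fun g hg => ⟨g, hg, rfl⟩
      have hHS : tauImage hζ H ≤ tauImage hζ S := by
        rintro _ ⟨h, hh, hm⟩
        refine ⟨h, hS ⟨h, Subgroup.le_normalizer hh⟩ ?_, hm⟩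
        rw [(QuotientGroup.eq_one_iff _).mpr (Subgroup.mem_subgroupOf.mpr hh), map_one]
        exact one_mem _
      have hFS : famSpan e f ≤ tauImage hζ S := famSpan_le.mpr
        ⟨fun r => ⟨Z r, hS ⟨Z r, hZN r⟩ (by rw [hρZ]; exact (pauliZ d j ζ r).2), hZ r⟩,
          fun r => ⟨X r, hS ⟨X r, hXN r⟩ (by rw [hρX]; exact (pauliX d j ζ r).2), hX r⟩⟩
      have hsc : pauliScalar d n ζ ∈ S :=
        hS ⟨_, hSN⟩ (by rw [hρS]; exact (pauliScalar d j ζ).2)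
      rintro _ ⟨q, rfl⟩
      induction q using QuotientGroup.induction_on with
      | H g =>
        have h1 := hF'.trans (sup_le hHS hFS) ((hH.mem_normalizer_iff hζ).mp g.2)
        obtain ⟨g', hg', hgg'⟩ := mem_of_symb_mem hζ hsc h1
        have h2 : g' = g := Subtype.ext hgg'
        rw [← h2]
        exact hg'
    · rintro _ ((⟨r, rfl⟩ | ⟨r, rfl⟩) | rfl)
      exacts [⟨_, hρX r⟩, ⟨_, hρZ r⟩, ⟨_, hρS⟩]
  refine ⟨(MonoidHom.ofInjective hinj).trans (MulEquiv.subgroupCongr hrange), U, fun g v => ?_⟩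
  exact (transportRep_apply U.toLinearEquiv g v).symm

end Equivariance
-- From an abstract isomorphism to a symplectic complement
section Converse

variable {d n j : ℕ} [NeZero d] {ζ : ℂˣ} (hζ : IsPrimitiveRoot ζ (dbar d))
  {H : Subgroup (Pauli d n ζ)}

/-- The centre of the Pauli group is the kernel of `τ`. -/
theorem symb_eq_zero_iff_central (g : Pauli d n ζ) :
    symb hζ g = 0 ↔ ∀ g' : Pauli d n ζ, g * g' = g' * g := by
  simp_rw [mul_comm_iff hζ]
  rw [← (symb_surjective hζ).forall (p := fun m => sympForm d n (symb hζ g) m = 0)]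
  exact ⟨fun h m => by rw [h, map_zero, LinearMap.zero_apply], eq_zero_of_sympForm_eq_zero⟩

/-- The centre of `N(H)/H` consists of the classes of elements `g` with `τ(g) ∈ τ(H)`. -/
theorem mk_central_iff (hH : IsStabilizer H)
    (g : Subgroup.normalizer (H : Set (Pauli d n ζ))) :
    (∀ q : NormQuot H, (g : NormQuot H) * q = q * g) ↔
      symb hζ (g : Pauli d n ζ) ∈ tauImage hζ H := by
  have h1 : ∀ g' : Subgroup.normalizer (H : Set (Pauli d n ζ)),
      (g : NormQuot H) * (g' : NormQuot H) = (g' : NormQuot H) * (g : NormQuot H) ↔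
        sympForm d n (symb hζ (g : Pauli d n ζ)) (symb hζ (g' : Pauli d n ζ)) = 0 := by
    intro g'
    rw [← mul_comm_iff hζ, ← QuotientGroup.mk_mul, ← QuotientGroup.mk_mul]
    refine ⟨fun h => ?_, fun h => congrArg _ (Subtype.ext h)⟩
    -- A commutator has symbol zero, so if it lies in H it is trivial.
    rw [QuotientGroup.eq, Subgroup.mem_subgroupOf] at h
    have h2 := hH.eq_one_of_symb hζ h (by
      simp only [Subgroup.coe_mul, Subgroup.coe_inv, symb_mul, symb_inv]
      abel)
    rw [Subgroup.coe_mul, Subgroup.coe_inv, inv_mul_eq_one] at h2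
    exact h2
  rw [← orth_orth (N := tauImage hζ H), mem_orth]
  refine ⟨fun h m hm => ?_, fun h q => ?_⟩
  · obtain ⟨y, rfl⟩ := symb_surjective hζ m
    exact (h1 ⟨y, (hH.mem_normalizer_iff hζ).mpr hm⟩).mp (h _)
  · induction q using QuotientGroup.induction_on with
    | H g' => exact (h1 g').mpr (h _ ((hH.mem_normalizer_iff hζ).mp g'.2))

/-- If `N(H)/H` is isomorphic to a Pauli group, `τ(H)` has a symplectic complement in its
orthogonal. -/
theorem hasSymplecticComplement_of_mulEquiv (hH : IsStabilizer H)
    (Θ : NormQuot H ≃* Pauli d j ζ) : HasSymplecticComplement (tauImage hζ H) j := by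
  rcases eq_or_ne d 1 with hd1 | hd1
  · exact hasSymplecticComplement_of_dim_one hd1 _ j
  have hd : 1 < d := by have := NeZero.ne d; omega
  set L := tauImage hζ H with hLdef
  -- R is the correspondence induced by Θ on symbols. It stands in for the isomorphism of L^⊥/L with
  -- the symplectic module of P_j.
  let R : Submodule (ZMod d) (SympMod d j × SympMod d n) := AddSubgroup.toZModSubmodule d
    { carrier := {p | ∃ g : Subgroup.normalizer (H : Set (Pauli d n ζ)),
        symb hζ (Θ (g : NormQuot H)) = p.1 ∧ symb hζ (g : Pauli d n ζ) = p.2}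
      zero_mem' := ⟨1, by rw [QuotientGroup.mk_one, map_one, symb_one]; rfl, symb_one hζ⟩
      add_mem' := by
        rintro _ _ ⟨g, h1, h2⟩ ⟨g', h1', h2'⟩
        refine ⟨g * g', ?_, ?_⟩
        · rw [QuotientGroup.mk_mul, map_mul, symb_mul, h1, h1', Prod.fst_add]
        · rw [Subgroup.coe_mul, symb_mul, h2, h2', Prod.snd_add]
      neg_mem' := by
        rintro _ ⟨g, h1, h2⟩
        refine ⟨g⁻¹, ?_, ?_⟩
        · rw [QuotientGroup.mk_inv, map_inv, symb_inv, h1, Prod.fst_neg]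
        · rw [Subgroup.coe_inv, symb_inv, h2, Prod.snd_neg] }
  have hR : ∀ {p}, p ∈ R ↔ ∃ g : Subgroup.normalizer (H : Set (Pauli d n ζ)),
      symb hζ (Θ (g : NormQuot H)) = p.1 ∧ symb hζ (g : Pauli d n ζ) = p.2 := Iff.rfl
  -- Both sides express centrality, which Θ preserves; nothing is assumed about Θ on scalars or on
  -- φ.
  have hRL : ∀ {p}, p ∈ R → (p.1 = 0 ↔ p.2 ∈ L) := by
    rintro p hp
    obtain ⟨g, h1, h2⟩ := hR.mp hp
    rw [← h1, ← h2, symb_eq_zero_iff_central, ← mk_central_iff hζ hH, Θ.surjective.forall]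
    simp_rw [← map_mul, Θ.injective.eq_iff]
  have hRo : ∀ {p}, p ∈ R → p.2 ∈ orth L := by
    rintro p hp
    obtain ⟨g, -, h2⟩ := hR.mp hp
    rw [← h2]
    exact (hH.mem_normalizer_iff hζ).mp g.2
  -- R projects onto a free module, so the projection splits; the range of s is the required
  -- complement.
  obtain ⟨s, hs⟩ : ∃ s : SympMod d j →ₗ[ZMod d] SympMod d n, ∀ v, (v, s v) ∈ R := by
    obtain ⟨s, hs⟩ := Module.projective_lifting_property
      ((LinearMap.fst (ZMod d) (SympMod d j) (SympMod d n)).comp R.subtype) LinearMap.id (by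
        intro v
        obtain ⟨p, rfl⟩ := symb_surjective hζ v
        obtain ⟨q, rfl⟩ := Θ.surjective p
        induction q using QuotientGroup.induction_on with
        | H g => exact ⟨⟨(_, symb hζ (g : Pauli d n ζ)), hR.mpr ⟨g, rfl, rfl⟩⟩, rfl⟩)
    refine ⟨(LinearMap.snd (ZMod d) _ _).comp (R.subtype.comp s), fun v => ?_⟩
    have h1 : (s v).1.1 = v := LinearMap.congr_fun hs v
    convert (s v).2 using 1
    exact Prod.ext h1.symm rfl
  have hsL : ∀ v, s v ∈ L → v = 0 := fun v hv => (hRL (hs v)).mpr hv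
  have hsinj : Function.Injective s := (injective_iff_map_eq_zero s).mpr fun v hv =>
    hsL v (by rw [hv]; exact zero_mem L)
  have hF : LinearMap.range s ≤ orth L := by
    rintro _ ⟨v, rfl⟩
    exact hRo (hs v)
  have hF' : orth L ≤ L ⊔ LinearMap.range s := by
    intro m hm
    obtain ⟨g, rfl⟩ := symb_surjective hζ m
    have h1 : (_, symb hζ g) ∈ R := hR.mpr ⟨⟨g, (hH.mem_normalizer_iff hζ).mpr hm⟩, rfl, rfl⟩
    have h2 := (hRL (sub_mem h1 (hs _))).mp (sub_self _)
    rw [← sub_add_cancel (symb hζ g) (s _)]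
    exact add_mem (Submodule.mem_sup_left h2) (Submodule.mem_sup_right ⟨_, rfl⟩)
  -- A radical vector of the complement is also orthogonal to L, hence lies in L^⊥⊥ = L, which meets
  -- the complement only in 0.
  have hnd : LinearMap.range s ⊓ orth (LinearMap.range s) = ⊥ := by
    rw [Submodule.eq_bot_iff]
    rintro _ ⟨⟨v, rfl⟩, hx⟩
    have h1 : s v ∈ L := by
      rw [← orth_orth (N := L), mem_orth]
      intro y hy
      obtain ⟨l, hl, x, hx', rfl⟩ := Submodule.mem_sup.mp (hF' hy)
      rw [map_add, mem_orth.mp (hF ⟨v, rfl⟩) l hl, mem_orth.mp hx x hx', add_zero]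
    rw [hsL v h1, map_zero]
  have hr : TorsionRank d (LinearMap.range s) (2 * j) :=
    torsionRank_top.congr (Submodule.topEquiv.trans
      (LinearEquiv.ofInjective s hsinj)).toAddEquiv
  obtain ⟨L', hL'⟩ := exists_lagrangian (LinearMap.range s)
  obtain ⟨j', e, f, -, hj, hfam, hspan, -⟩ := exists_split_basis hd _ _ L' hnd hr hL'
  obtain rfl : j = j' := by omega
  exact ⟨e, f, hfam, hspan.le.trans hF, hspan ▸ hF'⟩

end Converse
end QuditPauli

/-! ### The equivalences and the equivariant isomorphism -/

theorem mainTheorem3 (d n : ℕ) [NeZero d] (ζ : ℂˣ)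
    (hζ : IsPrimitiveRoot ζ (QuditPauli.dbar d))
    (H : Subgroup (QuditPauli.Pauli d n ζ)) (hH : QuditPauli.IsStabilizer H) :
    ((∃ k ≤ n, Nonempty (QuditPauli.NormQuot H ≃* QuditPauli.Pauli d (n - k) ζ)) ↔
      QuditPauli.IsShiftedFree hζ H) ∧
    (QuditPauli.IsShiftedFree hζ H ↔
      QuditPauli.IsLagrangianInFreeSymplectic (QuditPauli.tauImage hζ H)) ∧
    (∀ k ≤ n, Nonempty (QuditPauli.NormQuot H ≃* QuditPauli.Pauli d (n - k) ζ) →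
      ∃ (Ψ : QuditPauli.NormQuot H ≃* QuditPauli.Pauli d (n - k) ζ)
        (U : QuditPauli.fixedSpace H ≃ₗᵢ[ℂ] QuditPauli.Qudits d (n - k)),
        ∀ (g : QuditPauli.NormQuot H) (v : QuditPauli.fixedSpace H),
          U (QuditPauli.quotRep H g v) =
            (Ψ g : QuditPauli.Qudits d (n - k) ≃ₗ[ℂ] QuditPauli.Qudits d (n - k)) (U v)) := by
  have hbc : QuditPauli.IsShiftedFree hζ H →
      QuditPauli.IsLagrangianInFreeSymplectic (QuditPauli.tauImage hζ H) := fun h =>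
    h.isLagrangian hζ
  have hCb : ∀ {k j : ℕ}, k ≤ n → k + j = n →
      QuditPauli.HasSymplecticComplement (QuditPauli.tauImage hζ H) j →
      QuditPauli.IsShiftedFree hζ H := fun hk hkj hC => by
    obtain ⟨e, f, a, hb, ha, hL⟩ := hC.exists_basis (hH.tauImage_le_orth hζ) hk hkj
    exact QuditPauli.isShiftedFree_of_basis hζ hH hk hb ha hL
  refine ⟨⟨?_, fun hb => ?_⟩, ⟨hbc, fun hc => ?_⟩, ?_⟩
  · rintro ⟨k, hk, ⟨Θ⟩⟩
    exact hCb hk (by omega) (QuditPauli.hasSymplecticComplement_of_mulEquiv hζ hH Θ)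
  · obtain ⟨j, hj, hC⟩ := (hbc hb).exists_complement
    obtain ⟨Ψ, -⟩ := QuditPauli.exists_equivariant_equiv hζ hH hC
    refine ⟨n - j, Nat.sub_le n j, ?_⟩
    rw [Nat.sub_sub_self hj]
    exact ⟨Ψ⟩
  · obtain ⟨j, hj, hC⟩ := hc.exists_complement
    exact hCb (Nat.sub_le n j) (Nat.sub_add_cancel hj) hC
  -- The given Θ need not be equivariant; it only provides the complement of rank 2(n - k), from
  -- which Ψ and U are built afresh.
  · rintro k - ⟨Θ⟩
    exact QuditPauli.exists_equivariant_equiv hζ hH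
      (QuditPauli.hasSymplecticComplement_of_mulEquiv hζ hH Θ)
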